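/- Let $(W,S)$ and $(W',S')$ be Coxeter systems with $W$ and $W'$ finite, let $m(s,t)$ be the order of $st$, let $l$ be the length function, and let $w_0'$ be the longest element of $W'$. The Coxeter diagram of $(W,S)$ has vertex set $S$ and an edge labelled $m(s,t)$ between $s\neq t$ whenever $m(s,t)>2$; an orientation $\vec G$ chooses one direction for each edge. The right weak order on $W$ is defined by $v\le w$ if and only if every reflection $t$ with $l(tv)<l(v)$ satisfies $l(tw)<l(w)$. The Cambrian congruence $\Theta(\vec G)$ is the smallest lattice congruence of the right weak order such that, for every directed edge $s\to t$ of $\vec G$, the element $t$ is equivalent to the element represented by the word $tsts\cdots$ with $m(s,t)-1$ letters. The Cambrian lattice $\mathcal C(\vec G)$ is the right weak order modulo $\Theta(\vec G)$; write $[w]$ for the class of $w$. An isomorphism (respectively anti-isomorphism) of directed diagrams is a bijection of the vertices that preserves edges and edge labels and preserves (respectively reverses) the directions of the edges. Let $\vec G$ and $\vec G'$ be orientations of the Coxeter diagrams of $(W,S)$ and $(W',S')$. 1. Every isomorphism $\varphi:\vec G\to\vec G'$ of directed diagrams extends to a group isomorphism $f:W\to W'$, and $[w]\mapsto[f(w)]$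 is a well-defined isomorphism of lattices $\mathcal C(\vec G)\to\mathcal C(\vec G')$. 2. Every anti-isomorphism $\varphi:\vec G\to\vec G'$ of directed diagrams extends to a group isomorphism $f:W\to W'$, and $[w]\mapsto[f(w)w_0']$ is a well-defined anti-isomorphism of lattices $\mathcal C(\vec G)\to\mathcal C(\vec G')$. 3. For every isomorphism of lattices $F:\mathcal C(\vec G)\to\mathcal C(\vec G')$ there is a unique bijection $\varphi:S\to S'$ that is an isomorphism of directed diagrams $\vec G\to\vec G'$ and satisfies $F([s])=[\varphi(s)]$ for all $s\in S$. 4. For every anti-isomorphism of lattices $F:\mathcal C(\vec G)\to\mathcal C(\vec G')$ there is a unique bijection $\varphi:S\to S'$ that is an anti-isomorphism of directed diagrams $\vec G\to\vec G'$ and satisfies $F([s])=[\varphi(s)w_0']$ for all $s\in S$. -/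

import Mathlib

namespace Cambrian

open CoxeterSystem

/-- An orientation of the Coxeter diagram of `M`. The diagram has an edge, with label `M s t`,
joining two distinct vertices `s`, `t` exactly when `M s t > 2`; in Mathlib the label `∞` is
encoded by `0`, so this reads `M s t ≠ 2`. Each edge is directed in exactly one way. -/
structure DirectedDiagram {B : Type*} (M : CoxeterMatrix B) where
  /-- `Arrow s t`: there is a directed edge `s → t`. -/
  Arrow : B → B → Prop
  arrow_or_arrow_iff : ∀ s t, (Arrow s t ∨ Arrow t s) ↔ (s ≠ t ∧ M s t ≠ 2)
  asymm : ∀ s t, Arrow s t → ¬ Arrow t s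

namespace DirectedDiagram

variable {B B' : Type*} {M : CoxeterMatrix B} {M' : CoxeterMatrix B'}

/-- A bijection on the vertices which preserves the directions and the labels of edges. -/
def IsIso (G : DirectedDiagram M) (G' : DirectedDiagram M') (φ : B ≃ B') : Prop :=
  (∀ s t, G.Arrow s t ↔ G'.Arrow (φ s) (φ t)) ∧
  ∀ s t, G.Arrow s t → M' (φ s) (φ t) = M s t

/-- A bijection on the vertices which reverses the directions and preserves the labels of
edges. -/
def IsAntiIso (G : DirectedDiagram M) (G' : DirectedDiagram M') (φ : B ≃ B') : Prop :=
  (∀ s t, G.Arrow s t ↔ G'.Arrow (φ t) (φ s)) ∧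
  ∀ s t, G.Arrow s t → M' (φ s) (φ t) = M s t

end DirectedDiagram

section WeakOrder

variable {B W : Type*} [Group W] {M : CoxeterMatrix B}

/-- The group `W`, to be equipped with its right weak order. -/
def WeakOrder (_cs : CoxeterSystem M W) : Type _ := W

/-- The right weak order: `v ≤ w` if and only if every left inversion of `v` (a reflection `t`
with `ℓ (t * v) < ℓ v`) is a left inversion of `w`. -/
instance (cs : CoxeterSystem M W) : Preorder (WeakOrder cs) where
  le v w := ∀ t : W, cs.IsLeftInversion v t → cs.IsLeftInversion w t
  le_refl _ _ h := h
  le_trans _ _ _ h₁ h₂ t h := h₂ t (h₁ t h)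

/-- The element of maximal length of a finite Coxeter group. -/
noncomputable def longest [Finite W] (cs : CoxeterSystem M W) : W :=
  (Finite.exists_max cs.length).choose

theorem length_le_length_longest [Finite W] (cs : CoxeterSystem M W) (w : W) :
    cs.length w ≤ cs.length (longest cs) :=
  (Finite.exists_max cs.length).choose_spec w

end WeakOrder

/-- An equivalence relation which respects joins and meets. In a lattice, `IsLUB {a, b} c` says
`c = a ⊔ b` and `IsGLB {a, b} c` says `c = a ⊓ b`. -/
structure IsLatticeCongruence {L : Type*} [Preorder L] (r : Setoid L) : Prop where
  sup : ∀ a₁ a₂ b₁ b₂ c₁ c₂ : L, r a₁ a₂ → r b₁ b₂ →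
    IsLUB {a₁, b₁} c₁ → IsLUB {a₂, b₂} c₂ → r c₁ c₂
  inf : ∀ a₁ a₂ b₁ b₂ c₁ c₂ : L, r a₁ a₂ → r b₁ b₂ →
    IsGLB {a₁, b₁} c₁ → IsGLB {a₂, b₂} c₂ → r c₁ c₂

section Lattice

variable {B W : Type*} [Group W] {M : CoxeterMatrix B}

/-- The Cambrian congruence: the smallest lattice congruence of the right weak order such that,
for every arrow `s → t`, the simple reflection `t` is equivalent to the product of the word
`t s t s ⋯` with `M s t - 1` letters. Mathlib's `alternatingWord s t n` is the alternating word of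
`n` letters that ends in `t`, so its reversal is the one that starts with `t`. (In a finite
Coxeter group `M s t` is never `0`.) -/
def cambrianCongruence (cs : CoxeterSystem M W) (G : DirectedDiagram M) :
    Setoid (WeakOrder cs) :=
  sInf {r | IsLatticeCongruence r ∧ ∀ s t : B, G.Arrow s t →
    r (cs.simple t) (cs.wordProd (alternatingWord s t (M s t - 1)).reverse)}

/-- The Cambrian lattice: the right weak order modulo the Cambrian congruence. -/
def CambrianLattice (cs : CoxeterSystem M W) (G : DirectedDiagram M) : Type _ :=
  Quotient (cambrianCongruence cs G)

/-- The class of a group element in the Cambrian lattice. -/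
def CambrianLattice.mk (cs : CoxeterSystem M W) (G : DirectedDiagram M) (w : W) :
    CambrianLattice cs G :=
  Quotient.mk (cambrianCongruence cs G) w

/-- The order of the quotient: `p ≤ q` if and only if `x ≤ y` in the weak order for some
representatives `x` of `p` and `y` of `q`. -/
instance (cs : CoxeterSystem M W) (G : DirectedDiagram M) : LE (CambrianLattice cs G) where
  le p q := ∃ x y : WeakOrder cs,
    CambrianLattice.mk cs G x = p ∧ CambrianLattice.mk cs G y = q ∧ x ≤ y

end Lattice

end Cambrian

/-!
# Isomorphisms of Cambrian lattices

Everything is read off from the sets `N(w)` of left inversions. The operators `flipAt` satisfy the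
Coxeter relations, so that the indicator function of `N(w)` is a cocycle:
`N(u v) = N(u) ∆ u N(v) u⁻¹` (`isLeftInversion_mul_iff`). Hence `w` is determined by `N(w)`, the map
`w ↦ w w₀` complements `N(w)`, and for every standard parabolic subgroup `W_I` there are elements
with left inversions `N(w) ∩ W_I` and `N(w) ∪ (T \ W_I)`, where `T` is the set of reflections. These
two elements show that the parabolic factor of `w` is compatible with the joins and meets that exist
(`inv_inter_subset_of_isLUB`, `inv_inter_subset_of_isGLB`). It is never needed that the weak order is
a lattice. The geometric representation shows that `s t` has order exactly `M s t`, and that a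
standard parabolic subgroup contains no other simple reflections than its generators.

*From diagrams to lattices.* An isomorphism of diagrams preserves the Coxeter matrix, so it extends
to the groups and carries weak order and generators of the congruence along. For anti-isomorphisms it
suffices to treat `w ↦ w w₀` between a diagram and its opposite (`exists_orderIso_op`): if `c` has
the left inversions `T \ W_{s,t}`, this map turns the generating pair of an edge into the joins with
`c` of the generating pair of the opposite edge.

*From lattices to diagrams.* Two explicit lattice congruences contain the Cambrian congruence:
`simpleSetoid`, which detects whether `s` lies below an element, and, for an edge `s → t`,
`polygonSetoid`, the Cambrian congruence of the dihedral group `W_{s,t}` pulled back along the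
parabolic factor. The first one shows that the atoms of the Cambrian lattice are the classes of the
simple reflections (`exists_eq_mk_simple_iff`) and that `[s]` and `[t]` have as join the class of the
longest element of `W_{s,t}` (`top_le_iff`). The second one shows that the interval from `[s]` to this
join has `M s t` elements if there is an edge `s → t`; otherwise it has two (`ncard_side_of_arrow`,
`ncard_side_of_not_arrow`). So the bijection of atoms given by an isomorphism of Cambrian lattices
preserves edges, directions and labels. Anti-isomorphisms are composed with `w ↦ w w₀`.
-/

namespace Cambrian

open CoxeterSystem

/-! ### The inversion cocycle -/

section Cocycle

variable {B W : Type*} [Group W] {M : CoxeterMatrix B} (cs : CoxeterSystem M W)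

open Classical in
/-- The action of a simple reflection `s` on `ZMod 2`-valued functions on `W`: conjugate by `s` and
flip the value at `s`. -/
noncomputable def flipAt (i : B) : Function.End (W → ZMod 2) :=
  fun g x ↦ (if x = cs.simple i then 1 else 0) + g (cs.simple i * x * cs.simple i)

theorem mul_simple_pow_mul_simple (i j : B) (k : ℕ) :
    cs.simple i * cs.simple j * ((cs.simple i * cs.simple j) ^ k * cs.simple i) *
      (cs.simple j * cs.simple i) = (cs.simple i * cs.simple j) ^ (k + 2) * cs.simple i := by
  rw [pow_succ, pow_succ']
  simp only [mul_assoc]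

open Classical in
theorem flipAt_mul_flipAt_pow (i j : B) (n : ℕ) (g : W → ZMod 2) (x : W) :
    ((flipAt cs i * flipAt cs j) ^ n) g x =
      (∑ k ∈ Finset.range (2 * n),
        if x = (cs.simple i * cs.simple j) ^ k * cs.simple i then (1 : ZMod 2) else 0) +
      g ((cs.simple j * cs.simple i) ^ n * x * (cs.simple i * cs.simple j) ^ n) := by
  induction n generalizing x with
  | zero => simp; rfl
  | succ n ih =>
    rw [pow_succ']
    change (if x = cs.simple i then (1 : ZMod 2) else 0) +
      ((if cs.simple i * x * cs.simple i = cs.simple j then (1 : ZMod 2) else 0) +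
        ((flipAt cs i * flipAt cs j) ^ n) g
          (cs.simple j * (cs.simple i * x * cs.simple i) * cs.simple j)) = _
    rw [ih, show 2 * (n + 1) = 2 * n + 1 + 1 from rfl, Finset.sum_range_succ',
      Finset.sum_range_succ']
    have h1 : (cs.simple i * x * cs.simple i = cs.simple j) ↔
        x = (cs.simple i * cs.simple j) ^ (0 + 1) * cs.simple i := by
      constructor
      · intro h; rw [zero_add, pow_one, ← h]; simp [mul_assoc]
      · rintro rfl; simp [mul_assoc]
    have h2 (k : ℕ) : (cs.simple j * (cs.simple i * x * cs.simple i) * cs.simple j =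
        (cs.simple i * cs.simple j) ^ k * cs.simple i) ↔
        x = (cs.simple i * cs.simple j) ^ (k + 1 + 1) * cs.simple i := by
      rw [← mul_simple_pow_mul_simple]
      constructor
      · intro h; rw [← h]; simp [mul_assoc]
      · intro h; rw [h]; simp [mul_assoc]
    simp only [h1, h2]
    rw [pow_succ' (cs.simple i * cs.simple j) n, pow_succ (cs.simple j * cs.simple i) n, pow_zero,
      one_mul]
    simp only [mul_assoc]
    ring

/-- The operators `flipAt` satisfy the Coxeter relations: in the `m`-th power of a product of two of
them, each value is flipped an even number of times. -/
theorem isLiftable_flipAt : M.IsLiftable (flipAt cs) := by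
  classical
  intro i j
  funext g x
  rw [flipAt_mul_flipAt_pow, two_mul, Finset.sum_range_add]
  have h : ∀ k, (cs.simple i * cs.simple j) ^ (M i j + k) = (cs.simple i * cs.simple j) ^ k :=
    fun k ↦ by rw [pow_add, cs.simple_mul_simple_pow, one_mul]
  simp only [h, CharTwo.add_self_eq_zero, cs.simple_mul_simple_pow, cs.simple_mul_simple_pow']
  simp; rfl

/-- The inversion cocycle `W → (W → ZMod 2)`, whose value at `w` turns out to be the indicator
function of the set of left inversions of `w`. -/
noncomputable def cocycle (w : W) : W → ZMod 2 := cs.lift ⟨flipAt cs, isLiftable_flipAt cs⟩ w 0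

theorem lift_flipAt_apply (w : W) (g : W → ZMod 2) (x : W) :
    cs.lift ⟨flipAt cs, isLiftable_flipAt cs⟩ w g x = cocycle cs w x + g (w⁻¹ * x * w) := by
  classical
  induction w using cs.simple_induction_left generalizing g x with
  | one => simp only [cocycle, map_one]; simp [Function.End.one_def]
  | mul_simple_left w i ih =>
    simp only [cocycle, map_mul, cs.lift_apply_simple]
    change (if _ then (1 : ZMod 2) else 0) + (cs.lift ⟨flipAt cs, isLiftable_flipAt cs⟩ w) _ _ =
      (if _ then (1 : ZMod 2) else 0) + (cs.lift ⟨flipAt cs, isLiftable_flipAt cs⟩ w) _ _ + _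
    rw [ih, ih]
    simp [mul_assoc, add_assoc]

theorem cocycle_one : cocycle cs 1 = 0 := by
  simp only [cocycle, map_one]; rfl

theorem cocycle_mul (u v x : W) :
    cocycle cs (u * v) x = cocycle cs u x + cocycle cs v (u⁻¹ * x * u) := by
  rw [← lift_flipAt_apply]
  simp only [cocycle, map_mul]; rfl

open Classical in
theorem cocycle_simple (i : B) (x : W) :
    cocycle cs (cs.simple i) x = if x = cs.simple i then 1 else 0 := by
  simp only [cocycle, cs.lift_apply_simple]
  simp [flipAt]

theorem cocycle_self {t : W} (ht : cs.IsReflection t) : cocycle cs t t = 1 := by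
  obtain ⟨w, i, rfl⟩ := ht
  have h := cocycle_mul cs w w⁻¹ (w * cs.simple i * w⁻¹)
  rw [mul_inv_cancel, cocycle_one] at h
  rw [cocycle_mul, cocycle_mul]
  simp only [mul_assoc, inv_mul_cancel_left, inv_mul_cancel, mul_one, mul_inv_rev, inv_simple,
    Pi.zero_apply, simple_mul_simple_cancel_left, cocycle_simple, if_true] at h ⊢
  linear_combination -h

theorem mem_leftInvSeq_of_cocycle_ne_zero (ω : List B) (t : W)
    (h : cocycle cs (cs.wordProd ω) t ≠ 0) : t ∈ cs.leftInvSeq ω := by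
  classical
  induction ω generalizing t with
  | nil => simp [cocycle_one] at h
  | cons i ω ih =>
    rw [wordProd_cons, cocycle_mul, cocycle_simple] at h
    rw [leftInvSeq, List.mem_cons]
    by_cases hti : t = cs.simple i
    · exact Or.inl hti
    · rw [if_neg hti, zero_add] at h
      exact Or.inr (List.mem_map.2 ⟨_, ih _ h, by simp [mul_assoc]⟩)

/-- The strong exchange condition, in the form that the cocycle detects left inversions. -/
theorem isLeftInversion_iff_cocycle (w : W) {t : W} (ht : cs.IsReflection t) :
    cs.IsLeftInversion w t ↔ cocycle cs w t ≠ 0 := by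
  have key : ∀ w : W, cocycle cs w t ≠ 0 → cs.IsLeftInversion w t := by
    intro w h
    obtain ⟨ω, hω, rfl⟩ := cs.exists_isReduced w
    exact cs.isLeftInversion_of_mem_leftInvSeq hω (mem_leftInvSeq_of_cocycle_ne_zero cs ω t h)
  refine ⟨fun h h0 ↦ ?_, key w⟩
  refine (ht.isLeftInversion_mul_right_iff (w := w)).1 (key _ ?_) h
  rw [cocycle_mul, cocycle_self cs ht, ht.inv, ht.mul_self, one_mul, h0]
  simp

theorem isLeftInversion_mul_iff (u v t : W) :
    cs.IsLeftInversion (u * v) t ↔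
      ¬ (cs.IsLeftInversion u t ↔ cs.IsLeftInversion v (u⁻¹ * t * u)) := by
  by_cases ht : cs.IsReflection t
  · have ht' : cs.IsReflection (u⁻¹ * t * u) := by simpa using ht.conj u⁻¹
    rw [isLeftInversion_iff_cocycle cs _ ht, isLeftInversion_iff_cocycle cs _ ht,
      isLeftInversion_iff_cocycle cs _ ht', cocycle_mul]
    generalize cocycle cs u t = a
    generalize cocycle cs v _ = b
    revert a b
    decide
  · have ht' : ¬ cs.IsReflection (u⁻¹ * t * u) := fun h ↦ ht (by simpa [mul_assoc] using h.conj u)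
    simp [IsLeftInversion, ht, ht']

theorem not_isLeftInversion_one (t : W) : ¬ cs.IsLeftInversion 1 t := by
  simp [IsLeftInversion]

theorem isLeftInversion_simple_iff (i : B) (t : W) :
    cs.IsLeftInversion (cs.simple i) t ↔ t = cs.simple i := by
  classical
  by_cases ht : cs.IsReflection t
  · rw [isLeftInversion_iff_cocycle cs _ ht, cocycle_simple]
    simp
  · refine ⟨fun h ↦ absurd h.1 ht, ?_⟩
    rintro rfl
    exact absurd (cs.isReflection_simple i) ht

theorem isLeftInversion_inv_iff' (w t : W) :
    cs.IsLeftInversion w⁻¹ t ↔ cs.IsLeftInversion w (w * t * w⁻¹) := by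
  have h := isLeftInversion_mul_iff cs w⁻¹ w t
  rw [inv_mul_cancel, inv_inv] at h
  have := not_isLeftInversion_one cs t
  tauto

/-- An element of a Coxeter group is determined by its left inversions. -/
theorem eq_of_isLeftInversion_iff {u v : W}
    (h : ∀ t, cs.IsLeftInversion u t ↔ cs.IsLeftInversion v t) : u = v := by
  by_contra hne
  obtain ⟨i, hi⟩ := cs.exists_leftDescent_of_ne_one (w := u⁻¹ * v)
    (fun h' ↦ hne (by simpa [inv_mul_eq_one] using h'))
  rw [← isLeftInversion_simple_iff_isLeftDescent, isLeftInversion_mul_iff,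
    isLeftInversion_inv_iff', inv_inv, ← h] at hi
  exact hi Iff.rfl

section Finite

variable [Finite W]

theorem isLeftInversion_longest_iff (t : W) :
    cs.IsLeftInversion (longest cs) t ↔ cs.IsReflection t :=
  ⟨fun h ↦ h.1, fun h ↦ ⟨h, lt_of_le_of_ne (length_le_length_longest cs _)
    (h.length_mul_right_ne _)⟩⟩

theorem isLeftInversion_mul_longest_iff (w t : W) :
    cs.IsLeftInversion (w * longest cs) t ↔ cs.IsReflection t ∧ ¬ cs.IsLeftInversion w t := by
  have h : cs.IsReflection (w⁻¹ * t * w) ↔ cs.IsReflection t := by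
    simpa using cs.isReflection_conj_iff w⁻¹ t
  rw [isLeftInversion_mul_iff, isLeftInversion_longest_iff, h]
  have : cs.IsLeftInversion w t → cs.IsReflection t := fun h ↦ h.1
  tauto

theorem longest_mul_longest : longest cs * longest cs = 1 := by
  refine eq_of_isLeftInversion_iff cs fun t ↦ ?_
  rw [isLeftInversion_mul_longest_iff, isLeftInversion_longest_iff]
  simp [not_isLeftInversion_one]

end Finite

end Cocycle

/-! ### The geometric representation -/

section Geometric

variable {B W : Type*} [Group W] {M : CoxeterMatrix B} (cs : CoxeterSystem M W)

/-- The coroot of `i`, a linear form on the space with basis the simple roots `e j`. Its value at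
`e j` is `-2 cos (π / M i j)`, which for `M i j = 0` (the label `∞`) has to be read as `-2`; the
junk value `π / 0 = 0` takes care of that. -/
noncomputable def coroot (M : CoxeterMatrix B) (i : B) : Module.Dual ℝ (B →₀ ℝ) :=
  Finsupp.linearCombination ℝ fun j ↦ -2 * Real.cos (Real.pi / M i j)

theorem coroot_single (i j : B) :
    coroot M i (Finsupp.single j 1) = -2 * Real.cos (Real.pi / M i j) := by
  simp [coroot]

theorem coroot_self (i : B) : coroot M i (Finsupp.single i 1) = 2 := by
  simp [coroot_single]

/-- The reflection in the simple root `e i`. -/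
noncomputable def simpleReflection (M : CoxeterMatrix B) (i : B) : (B →₀ ℝ) ≃ₗ[ℝ] (B →₀ ℝ) :=
  Module.reflection (coroot_self (M := M) i)

theorem simpleReflection_apply (i : B) (v : B →₀ ℝ) :
    simpleReflection M i v = v - coroot M i v • Finsupp.single i 1 :=
  Module.reflection_apply _ (coroot_self i)

/-- The trace parameter of a product of two simple reflections, as a double-angle cosine. -/
theorem coroot_mul_coroot_sub_two (i j : B) :
    coroot M i (Finsupp.single j 1) * coroot M j (Finsupp.single i 1) - 2 =
      2 * Real.cos (2 * Real.pi / M i j) := by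
  rw [coroot_single, coroot_single, M.symmetric j i, mul_div_assoc, Real.cos_two_mul]
  ring

theorem sin_two_pi_div_ne_zero {m : ℕ} (h : 3 ≤ m) : Real.sin (2 * Real.pi / m) ≠ 0 := by
  have hm : (3 : ℝ) ≤ m := by exact_mod_cast h
  refine (Real.sin_pos_of_pos_of_lt_pi (by positivity) ?_).ne'
  rw [div_lt_iff₀ (by positivity)]
  nlinarith [Real.pi_pos]

theorem simpleReflection_mul_pow (i j : B) :
    (simpleReflection M i * simpleReflection M j) ^ M i j = 1 := by
  obtain hm | hm | hm | hm : M i j = 0 ∨ M i j = 1 ∨ M i j = 2 ∨ 3 ≤ M i j := by omega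
  · rw [hm, pow_zero]
  · have hij : i = j := by
      by_contra h
      exact M.off_diagonal i j h hm
    subst hij
    rw [hm, pow_one]
    refine LinearEquiv.ext fun v ↦ ?_
    rw [LinearEquiv.mul_apply, simpleReflection_apply, simpleReflection_apply, map_sub, map_smul,
      coroot_self, LinearEquiv.coe_one, id_eq]
    module
  · have h1 : coroot M i (Finsupp.single j 1) = 0 := by simp [coroot_single, hm]
    have h2 : coroot M j (Finsupp.single i 1) = 0 := by simp [coroot_single, M.symmetric j i, hm]
    refine LinearEquiv.ext fun v ↦ ?_
    rw [hm, pow_two]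
    simp only [LinearEquiv.mul_apply, simpleReflection_apply, map_sub, map_smul, h1, h2,
      coroot_self, LinearEquiv.coe_one, id_eq]
    module
  · have hs := sin_two_pi_div_ne_zero hm
    have hm0 : (M i j : ℝ) ≠ 0 := by positivity
    have hS : ∀ k : ℤ, (Polynomial.Chebyshev.S ℝ k).eval (2 * Real.cos (2 * Real.pi / M i j)) =
        Real.sin ((k + 1) * (2 * Real.pi / M i j)) / Real.sin (2 * Real.pi / M i j) := fun k ↦ by
      rw [eq_div_iff hs, Polynomial.Chebyshev.S_two_mul_real_cos]
    refine LinearEquiv.ext fun v ↦ ?_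
    rw [simpleReflection, simpleReflection, Module.reflection_mul_reflection_pow_apply _ _ _ _
      (2 * Real.cos (2 * Real.pi / M i j)) (coroot_mul_coroot_sub_two i j).symm]
    -- Each coefficient contains a factor `sin (k α)` or `sin (k α) + sin ((k + 1) α)` that vanishes,
    -- where `α = 2 π / m`, and `m = 2 k` or `m = 2 k + 1`.
    have hz : ∀ a b : ℝ, a + b = M i j → Real.sin (a * (2 * Real.pi / M i j)) +
        Real.sin (b * (2 * Real.pi / M i j)) = 0 := by
      intro a b hab
      have : a * (2 * Real.pi / M i j) = 2 * Real.pi - b * (2 * Real.pi / M i j) := by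
        field_simp
        linear_combination hab
      rw [this, Real.sin_two_pi_sub]
      ring
    have hA : (Polynomial.Chebyshev.S ℝ (((M i j : ℕ) - 2) / 2)).eval
          (2 * Real.cos (2 * Real.pi / M i j)) *
        ((Polynomial.Chebyshev.S ℝ (((M i j : ℕ) - 1) / 2)).eval
            (2 * Real.cos (2 * Real.pi / M i j)) +
          (Polynomial.Chebyshev.S ℝ (((M i j : ℕ) - 3) / 2)).eval
            (2 * Real.cos (2 * Real.pi / M i j))) = 0 := by
      obtain ⟨k, hk | hk⟩ := Nat.even_or_odd' (M i j)
      · have e : (((M i j : ℕ) : ℤ) - 2) / 2 = k - 1 := by omega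
        have : (k : ℝ) + k = M i j := by rw [hk]; push_cast; ring
        have := hz _ _ this
        rw [e, hS]
        push_cast
        rw [sub_add_cancel, show Real.sin (k * (2 * Real.pi / M i j)) = 0 by linarith]
        simp
      · have e1 : (((M i j : ℕ) : ℤ) - 1) / 2 = k := by omega
        have e2 : (((M i j : ℕ) : ℤ) - 3) / 2 = k - 1 := by omega
        have : (k + 1 : ℝ) + k = M i j := by rw [hk]; push_cast; ring
        have := hz _ _ this
        rw [e1, e2, hS k, hS (k - 1), ← add_div]
        push_cast
        rw [sub_add_cancel, this]
        simp
    have hB : (Polynomial.Chebyshev.S ℝ (((M i j : ℕ) - 1) / 2)).eval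
          (2 * Real.cos (2 * Real.pi / M i j)) *
        ((Polynomial.Chebyshev.S ℝ ((M i j : ℕ) / 2)).eval
            (2 * Real.cos (2 * Real.pi / M i j)) +
          (Polynomial.Chebyshev.S ℝ (((M i j : ℕ) - 2) / 2)).eval
            (2 * Real.cos (2 * Real.pi / M i j))) = 0 := by
      obtain ⟨k, hk | hk⟩ := Nat.even_or_odd' (M i j)
      · have e1 : (((M i j : ℕ) : ℤ) - 1) / 2 = k - 1 := by omega
        have : (k : ℝ) + k = M i j := by rw [hk]; push_cast; ring
        have := hz _ _ this
        rw [e1, hS (k - 1)]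
        push_cast
        rw [sub_add_cancel, show Real.sin (k * (2 * Real.pi / M i j)) = 0 by linarith]
        simp
      · have e1 : ((M i j : ℕ) : ℤ) / 2 = k := by omega
        have e2 : (((M i j : ℕ) : ℤ) - 2) / 2 = k - 1 := by omega
        have : (k + 1 : ℝ) + k = M i j := by rw [hk]; push_cast; ring
        have := hz _ _ this
        rw [e1, e2, hS k, hS (k - 1), ← add_div]
        push_cast
        rw [sub_add_cancel, this]
        simp
    rw [hA, hB]
    simp

/-- The geometric representation of a Coxeter group on the space with basis the simple roots. -/
noncomputable def geometricRep : W →* ((B →₀ ℝ) ≃ₗ[ℝ] (B →₀ ℝ)) :=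
  cs.lift ⟨simpleReflection M, simpleReflection_mul_pow⟩

theorem geometricRep_simple (i : B) : geometricRep cs (cs.simple i) = simpleReflection M i :=
  cs.lift_apply_simple _ _

/-- The geometric representation shows that the product of two simple reflections has the order
prescribed by the Coxeter matrix. -/
theorem orderOf_simple_mul_simple (i j : B) : orderOf (cs.simple i * cs.simple j) = M i j := by
  refine Nat.dvd_antisymm (orderOf_dvd_of_pow_eq_one (cs.simple_mul_simple_pow i j)) ?_
  by_cases hij : i = j
  · subst hij
    simp
  set n := orderOf (cs.simple i * cs.simple j) with hn
  have hpow : (simpleReflection M i * simpleReflection M j) ^ n = 1 := by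
    rw [← geometricRep_simple cs, ← geometricRep_simple cs, ← map_mul, ← map_pow, hn,
      pow_orderOf_eq_one, map_one]
  have hv := Module.reflection_mul_reflection_pow_apply_self (coroot_self (M := M) i)
    (coroot_self (M := M) j) n _ (coroot_mul_coroot_sub_two i j).symm
  change ((simpleReflection M i * simpleReflection M j) ^ n) _ = _ at hv
  rw [hpow] at hv
  have hi := DFunLike.congr_fun hv i
  have hj := DFunLike.congr_fun hv j
  simp only [LinearEquiv.coe_one, id_eq, Finsupp.add_apply, Finsupp.smul_apply,
    Finsupp.single_eq_same, Finsupp.single_eq_of_ne hij, Finsupp.single_eq_of_ne (Ne.symm hij),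
    smul_eq_mul, mul_one, mul_zero, add_zero, zero_add] at hi hj
  have hg : coroot M j (Finsupp.single i 1) = -2 * Real.cos (Real.pi / M i j) := by
    rw [coroot_single, M.symmetric j i]
  replace hj : 0 = (Polynomial.Chebyshev.S ℝ (n - 1)).eval (2 * Real.cos (2 * Real.pi / M i j)) *
      -(-2 * Real.cos (Real.pi / M i j)) := hg ▸ hj
  obtain hm | hm | hm | hm : M i j = 0 ∨ M i j = 1 ∨ M i j = 2 ∨ 3 ≤ M i j := by omega
  · rw [hm] at hj ⊢
    simp at hj
    simp [hj]
  · simp [hm]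
  · rw [hm] at hi ⊢
    by_contra hodd
    rw [← even_iff_two_dvd, Nat.not_even_iff_odd] at hodd
    have hodd' : Odd (n : ℤ) := by exact_mod_cast hodd
    simp [Polynomial.Chebyshev.S_eval_neg_two, Int.negOnePow_odd _ hodd',
      Int.negOnePow_even _ (hodd'.sub_odd odd_one)] at hi
    linarith
  · have hm3 : (3 : ℝ) ≤ M i j := by exact_mod_cast hm
    have hc : Real.cos (Real.pi / M i j) ≠ 0 := by
      refine (Real.cos_pos_of_mem_Ioo ⟨?_, ?_⟩).ne'
      · have : 0 < Real.pi / M i j := by positivity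
        linarith [Real.pi_pos]
      · rw [div_lt_div_iff₀ (by positivity) (by positivity)]
        nlinarith [Real.pi_pos]
    have hs := sin_two_pi_div_ne_zero hm
    have hS0 : (Polynomial.Chebyshev.S ℝ (n - 1)).eval (2 * Real.cos (2 * Real.pi / M i j)) = 0 := by
      have := hj.symm
      simpa [hc] using this
    rw [hS0, add_zero] at hi
    have h1 := Polynomial.Chebyshev.S_two_mul_real_cos (2 * Real.pi / M i j) n
    have h0 := Polynomial.Chebyshev.S_two_mul_real_cos (2 * Real.pi / M i j) (n - 1)
    rw [hS0, zero_mul] at h0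
    rw [← hi, one_mul] at h1
    push_cast at h0 h1
    rw [sub_add_cancel] at h0
    rw [add_mul, one_mul, Real.sin_add, ← h0, zero_mul, zero_add] at h1
    have hcos : Real.cos (n * (2 * Real.pi / M i j)) = 1 := by
      refine mul_right_cancel₀ hs ?_
      linarith
    obtain ⟨k, hk⟩ := (Real.cos_eq_one_iff _).1 hcos
    have hk' : (k : ℝ) * M i j = n := by
      have := Real.pi_pos
      field_simp at hk
      linarith
    have : (M i j : ℤ) ∣ n := ⟨k, by rw [mul_comm]; exact_mod_cast hk'.symm⟩
    exact_mod_cast this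

theorem geometricRep_apply_of_mem_closure {I : Set B} {w : W}
    (hw : w ∈ Subgroup.closure (cs.simple '' I)) {j : B} (hj : j ∉ I) (v : B →₀ ℝ) :
    geometricRep cs w v j = v j := by
  induction hw using Subgroup.closure_induction generalizing v with
  | mem x hx =>
    obtain ⟨i, hi, rfl⟩ := hx
    have hij : j ≠ i := fun h ↦ hj (h ▸ hi)
    rw [geometricRep_simple, simpleReflection_apply]
    simp [Finsupp.single_eq_of_ne hij]
  | one => simp
  | mul x y _ _ hx hy => rw [map_mul, LinearEquiv.mul_apply, hx, hy]
  | inv x _ hx =>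
    have := hx (geometricRep cs x⁻¹ v)
    rw [← LinearEquiv.mul_apply, ← map_mul, mul_inv_cancel, map_one] at this
    exact this.symm

/-- A simple reflection lies in a standard parabolic subgroup only if it is one of its
generators. -/
theorem simple_mem_closure_iff (I : Set B) (j : B) :
    cs.simple j ∈ Subgroup.closure (cs.simple '' I) ↔ j ∈ I := by
  refine ⟨fun h ↦ ?_, fun h ↦ Subgroup.subset_closure ⟨j, h, rfl⟩⟩
  by_contra hj
  have := geometricRep_apply_of_mem_closure cs h hj (Finsupp.single j 1)
  rw [geometricRep_simple, simpleReflection_apply, coroot_self] at this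
  norm_num at this

theorem simple_injective : Function.Injective cs.simple := by
  intro i j h
  have : cs.simple i ∈ Subgroup.closure (cs.simple '' {j}) :=
    h ▸ Subgroup.subset_closure ⟨j, rfl, rfl⟩
  exact (simple_mem_closure_iff cs {j} i).1 this

theorem matrix_ne_zero {B W : Type*} [Group W] {M : CoxeterMatrix B} (cs : CoxeterSystem M W)
    [Finite W] (i j : B) : M i j ≠ 0 := by
  rw [← orderOf_simple_mul_simple cs]
  exact (orderOf_pos _).ne'

end Geometric

/-! ### Parabolic factors -/

section Parabolic

variable {B W : Type*} [Group W] {M : CoxeterMatrix B} (cs : CoxeterSystem M W)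

/-- The standard parabolic subgroup generated by the simple reflections in `I`. -/
def parabolic (I : Set B) : Subgroup W := Subgroup.closure (cs.simple '' I)

theorem simple_mem_parabolic_iff {I : Set B} {i : B} : cs.simple i ∈ parabolic cs I ↔ i ∈ I :=
  simple_mem_closure_iff cs I i

theorem mem_parabolic_of_isLeftInversion {I : Set B} {w t : W} (hw : w ∈ parabolic cs I)
    (ht : cs.IsLeftInversion w t) : t ∈ parabolic cs I := by
  induction hw using Subgroup.closure_induction generalizing t with
  | mem x hx =>
    obtain ⟨i, hi, rfl⟩ := hx
    rw [isLeftInversion_simple_iff] at ht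
    exact ht ▸ (simple_mem_parabolic_iff cs).2 hi
  | one => exact absurd ht (not_isLeftInversion_one cs t)
  | mul x y hx hy ihx ihy =>
    rw [isLeftInversion_mul_iff] at ht
    by_cases h : cs.IsLeftInversion x t
    · exact ihx h
    · have h' := ihy (t := x⁻¹ * t * x) (by tauto)
      have h2 := mul_mem (mul_mem hx h') (inv_mem hx)
      simpa [mul_assoc, parabolic] using h2
  | inv x hx ih =>
    rw [isLeftInversion_inv_iff'] at ht
    have h2 := mul_mem (mul_mem (inv_mem hx) (ih ht)) hx
    simpa [mul_assoc, parabolic] using h2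

/-- The parabolic factor of `w`: its left inversions are the left inversions of `w` that lie in the
parabolic subgroup. It is obtained from a shortest element of the coset of `w`. -/
theorem exists_parabolic_factor (I : Set B) (w : W) : ∃ u ∈ parabolic cs I, ∀ t,
    cs.IsLeftInversion u t ↔ cs.IsLeftInversion w t ∧ t ∈ parabolic cs I := by
  have hne : {n | ∃ v ∈ parabolic cs I, cs.length (v * w) = n}.Nonempty := ⟨_, 1, one_mem _, rfl⟩
  obtain ⟨v, hv, hvn⟩ := Nat.sInf_mem hne
  have hmin : ∀ t ∈ parabolic cs I, ¬ cs.IsLeftInversion (v * w) t := by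
    intro t ht h
    have := Nat.sInf_le (s := {n | ∃ v ∈ parabolic cs I, cs.length (v * w) = n})
      ⟨t * v, mul_mem ht hv, rfl⟩
    rw [← hvn, mul_assoc] at this
    exact absurd h.2 (not_lt.2 this)
  refine ⟨v⁻¹, inv_mem hv, fun t ↦ ?_⟩
  have hw := isLeftInversion_mul_iff cs v⁻¹ (v * w) t
  rw [inv_mul_cancel_left] at hw
  constructor
  · intro h
    have ht := mem_parabolic_of_isLeftInversion cs (inv_mem hv) h
    have := hmin _ (mul_mem (mul_mem (inv_mem (inv_mem hv)) ht) (inv_mem hv))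
    tauto
  · rintro ⟨h, ht⟩
    have := hmin _ (mul_mem (mul_mem (inv_mem (inv_mem hv)) ht) (inv_mem hv))
    tauto

/-- The dual of the parabolic factor: the largest element with the same left inversions in the
parabolic subgroup as `w`. -/
theorem exists_parabolic_cofactor [Finite W] (I : Set B) (w : W) : ∃ u, ∀ t,
    cs.IsLeftInversion u t ↔
      cs.IsLeftInversion w t ∨ cs.IsReflection t ∧ t ∉ parabolic cs I := by
  obtain ⟨u, -, hu⟩ := exists_parabolic_factor cs I (w * longest cs)
  refine ⟨u * longest cs, fun t ↦ ?_⟩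
  rw [isLeftInversion_mul_longest_iff, hu, isLeftInversion_mul_longest_iff]
  have : cs.IsLeftInversion w t → cs.IsReflection t := fun h ↦ h.1
  tauto

end Parabolic

/-! ### The weak order -/

section Order

variable {B W : Type*} [Group W] {M : CoxeterMatrix B} {cs : CoxeterSystem M W}

namespace WeakOrder

/-- An element of the group, as an element of the weak order. -/
def of (cs : CoxeterSystem M W) (w : W) : WeakOrder cs := w

/-- The set of left inversions of an element of the weak order. -/
def inv (x : WeakOrder cs) : Set W := {t | cs.IsLeftInversion x t}

theorem le_iff {x y : WeakOrder cs} : x ≤ y ↔ x.inv ⊆ y.inv := Iff.rfl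

theorem inv_injective {x y : WeakOrder cs} (h : x.inv = y.inv) : x = y :=
  eq_of_isLeftInversion_iff cs fun t ↦ Set.ext_iff.1 h t

theorem isLUB_of_inv_eq {x y z : WeakOrder cs} (h : z.inv = x.inv ∪ y.inv) : IsLUB {x, y} z := by
  refine ⟨?_, fun u hu ↦ ?_⟩
  · rintro a (rfl | rfl)
    · exact le_iff.2 (h ▸ Set.subset_union_left)
    · exact le_iff.2 (h ▸ Set.subset_union_right)
  · exact le_iff.2 (h ▸ Set.union_subset (hu (Set.mem_insert _ _))
      (hu (Set.mem_insert_of_mem _ rfl)))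

theorem isGLB_of_inv_eq {x y z : WeakOrder cs} (h : z.inv = x.inv ∩ y.inv) : IsGLB {x, y} z := by
  refine ⟨?_, fun u hu ↦ ?_⟩
  · rintro a (rfl | rfl)
    · exact le_iff.2 (h ▸ Set.inter_subset_left)
    · exact le_iff.2 (h ▸ Set.inter_subset_right)
  · exact le_iff.2 (h ▸ Set.subset_inter (hu (Set.mem_insert _ _))
      (hu (Set.mem_insert_of_mem _ rfl)))

theorem inv_of_one : (of cs 1).inv = ∅ :=
  Set.eq_empty_of_forall_notMem fun t ↦ not_isLeftInversion_one cs t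

theorem inv_of_simple (i : B) : (of cs (cs.simple i)).inv = {cs.simple i} :=
  Set.ext fun t ↦ isLeftInversion_simple_iff cs i t

theorem exists_simple_mem_inv {x : WeakOrder cs} (h : x ≠ of cs 1) : ∃ i, cs.simple i ∈ x.inv := by
  obtain ⟨i, hi⟩ := cs.exists_leftDescent_of_ne_one (w := x) h
  exact ⟨i, (isLeftInversion_simple_iff_isLeftDescent cs _ _).2 hi⟩

/-- The reflections in the standard parabolic subgroup generated by `I`. -/
def reflections (cs : CoxeterSystem M W) (I : Set B) : Set W :=
  {t | cs.IsReflection t ∧ t ∈ parabolic cs I}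

theorem exists_inv_eq_inter (I : Set B) (x : WeakOrder cs) :
    ∃ y : WeakOrder cs, y.inv = x.inv ∩ reflections cs I := by
  obtain ⟨u, -, h⟩ := exists_parabolic_factor cs I x
  exact ⟨u, Set.ext fun t ↦ (h t).trans
    ⟨fun h ↦ ⟨h.1, h.1.1, h.2⟩, fun h ↦ ⟨h.1, h.2.2⟩⟩⟩

theorem exists_inv_eq_union [Finite W] (I : Set B) (x : WeakOrder cs) :
    ∃ y : WeakOrder cs, y.inv = x.inv ∪ {t | cs.IsReflection t ∧ t ∉ parabolic cs I} := by
  obtain ⟨u, h⟩ := exists_parabolic_cofactor cs I x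
  exact ⟨u, Set.ext h⟩

theorem inv_subset_reflections {I : Set B} {w : W} (hw : w ∈ parabolic cs I) :
    (of cs w).inv ⊆ reflections cs I :=
  fun _ ht ↦ ⟨ht.1, mem_parabolic_of_isLeftInversion cs hw ht⟩

theorem exists_mem_parabolic_of_inv_subset {I : Set B} {x : WeakOrder cs}
    (hx : x.inv ⊆ reflections cs I) : ∃ w ∈ parabolic cs I, x = of cs w := by
  obtain ⟨u, hu, h⟩ := exists_parabolic_factor cs I x
  exact ⟨u, hu, eq_of_isLeftInversion_iff cs fun t ↦
    ⟨fun ht ↦ (h t).2 ⟨ht, (hx ht).2⟩, fun ht ↦ ((h t).1 ht).1⟩⟩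

/-- The parabolic factor of a join is determined by the parabolic factors of the joinands. -/
theorem inv_inter_subset_of_isLUB [Finite W] {I : Set B} {x₁ x₂ y₁ y₂ c₁ c₂ : WeakOrder cs}
    (hx : x₁.inv ∩ reflections cs I ⊆ x₂.inv)
    (hy : y₁.inv ∩ reflections cs I ⊆ y₂.inv)
    (h₁ : IsLUB {x₁, y₁} c₁) (h₂ : IsLUB {x₂, y₂} c₂) :
    c₁.inv ∩ reflections cs I ⊆ c₂.inv := by
  obtain ⟨d, hd⟩ := exists_inv_eq_union I c₂
  have hle : c₁ ≤ d := by
    refine h₁.2 ?_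
    have key : ∀ a₁ a₂ : WeakOrder cs, a₁.inv ∩ reflections cs I ⊆ a₂.inv → a₂ ≤ c₂ → a₁ ≤ d := by
      intro a₁ a₂ ha hac t ht
      change t ∈ d.inv
      rw [hd]
      by_cases htI : t ∈ parabolic cs I
      · exact Or.inl (hac t (ha ⟨ht, ht.1, htI⟩))
      · exact Or.inr ⟨ht.1, htI⟩
    rintro a (rfl | rfl)
    · exact key _ _ hx (h₂.1 (Set.mem_insert _ _))
    · exact key _ _ hy (h₂.1 (Set.mem_insert_of_mem _ rfl))
  rintro t ⟨ht, htI⟩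
  have := le_iff.1 hle ht
  rw [hd] at this
  exact this.resolve_right fun h ↦ h.2 htI.2

/-- The parabolic factor of a meet is determined by the parabolic factors of its arguments. -/
theorem inv_inter_subset_of_isGLB {I : Set B} {x₁ x₂ y₁ y₂ c₁ c₂ : WeakOrder cs}
    (hx : x₁.inv ∩ reflections cs I ⊆ x₂.inv)
    (hy : y₁.inv ∩ reflections cs I ⊆ y₂.inv)
    (h₁ : IsGLB {x₁, y₁} c₁) (h₂ : IsGLB {x₂, y₂} c₂) :
    c₁.inv ∩ reflections cs I ⊆ c₂.inv := by
  obtain ⟨d, hd⟩ := exists_inv_eq_inter I c₁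
  have hle : d ≤ c₂ := by
    refine h₂.2 ?_
    rintro a (rfl | rfl)
    · exact le_iff.2 (hd ▸ fun t ht ↦ hx ⟨h₁.1 (Set.mem_insert _ _) t ht.1, ht.2⟩)
    · exact le_iff.2 (hd ▸ fun t ht ↦ hy ⟨h₁.1 (Set.mem_insert_of_mem _ rfl) t ht.1, ht.2⟩)
  exact hd ▸ le_iff.1 hle

theorem reflections_singleton (i : B) : reflections cs {i} = {cs.simple i} := by
  ext t
  constructor
  · rintro ⟨ht, htI⟩
    have hp : parabolic cs {i} = Subgroup.zpowers (cs.simple i) := by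
      rw [parabolic, Set.image_singleton, Subgroup.zpowers_eq_closure]
    rw [hp] at htI
    obtain ⟨k, rfl⟩ := Subgroup.mem_zpowers_iff.1 htI
    obtain ⟨l, rfl | rfl⟩ := Int.even_or_odd' k
    · rw [zpow_mul, zpow_ofNat, simple_sq, one_zpow] at ht
      have := ht.odd_length
      simp at this
    · rw [zpow_add, zpow_mul, zpow_ofNat, simple_sq, one_zpow, one_mul, zpow_one]
      rfl
  · rintro rfl
    exact ⟨cs.isReflection_simple i, (simple_mem_parabolic_iff cs).2 rfl⟩

theorem simple_mem_inv_of_isLUB [Finite W] (i : B) {x y c : WeakOrder cs} (h : IsLUB {x, y} c) :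
    cs.simple i ∈ c.inv ↔ cs.simple i ∈ x.inv ∨ cs.simple i ∈ y.inv := by
  constructor
  · intro hc
    by_contra! hxy
    have h1 : IsLUB {of cs 1, of cs 1} (of cs 1) := isLUB_of_inv_eq (by simp)
    have := inv_inter_subset_of_isLUB (I := {i}) (x₂ := of cs 1) (y₂ := of cs 1)
      (by rw [reflections_singleton]; rintro t ⟨ht, rfl⟩; exact absurd ht hxy.1)
      (by rw [reflections_singleton]; rintro t ⟨ht, rfl⟩; exact absurd ht hxy.2) h h1
    rw [reflections_singleton, inv_of_one] at this
    exact this ⟨hc, rfl⟩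
  · rintro (hx | hy)
    · exact h.1 (Set.mem_insert _ _) _ hx
    · exact h.1 (Set.mem_insert_of_mem _ rfl) _ hy

theorem of_simple_le_iff {i : B} {x : WeakOrder cs} :
    of cs (cs.simple i) ≤ x ↔ cs.simple i ∈ x.inv := by
  rw [le_iff, inv_of_simple, Set.singleton_subset_iff]

theorem simple_mem_inv_of_isGLB (i : B) {x y c : WeakOrder cs} (h : IsGLB {x, y} c) :
    cs.simple i ∈ c.inv ↔ cs.simple i ∈ x.inv ∧ cs.simple i ∈ y.inv := by
  constructor
  · exact fun hc ↦ ⟨h.1 (Set.mem_insert _ _) _ hc, h.1 (Set.mem_insert_of_mem _ rfl) _ hc⟩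
  · rintro ⟨hx, hy⟩
    rw [← of_simple_le_iff] at hx hy ⊢
    refine h.2 ?_
    rintro a (rfl | rfl) <;> assumption

end WeakOrder

end Order

/-! ### Dihedral parabolic subgroups -/

section Dihedral

variable {B W : Type*} [Group W] {M : CoxeterMatrix B} (cs : CoxeterSystem M W)

/-- The product `s t s ⋯` of `k` simple reflections, alternating between `s` and `t` and starting
with `s`. -/
def alternating (s t : B) : ℕ → W
  | 0 => 1
  | k + 1 => cs.simple s * alternating t s k

theorem wordProd_reverse_alternatingWord (s t : B) (k : ℕ) :
    cs.wordProd (alternatingWord s t k).reverse = alternating cs t s k := by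
  induction k generalizing s t with
  | zero => simp [alternatingWord, alternating]
  | succ k ih =>
    rw [alternatingWord_succ, List.concat_eq_append, List.reverse_append, List.reverse_singleton,
      List.singleton_append, wordProd_cons, ih, alternating]

theorem alternating_one (s t : B) : alternating cs s t 1 = cs.simple s := by
  simp [alternating]

theorem alternating_mem_parabolic {I : Set B} {s t : B} (hs : s ∈ I) (ht : t ∈ I) (k : ℕ) :
    alternating cs s t k ∈ parabolic cs I := by
  induction k generalizing s t with
  | zero => exact one_mem _
  | succ k ih => exact mul_mem ((simple_mem_parabolic_iff cs).2 hs) (ih ht hs)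

variable {cs}

open WeakOrder

theorem simple_mul_simple_pow_mul_simple (s t : B) (i : ℕ) :
    cs.simple s * ((cs.simple t * cs.simple s) ^ i * cs.simple t) * cs.simple s =
      (cs.simple s * cs.simple t) ^ (i + 1) * cs.simple s := by
  induction i with
  | zero => simp
  | succ i ih =>
    rw [pow_succ', pow_succ' _ (i + 1), mul_assoc (cs.simple s * cs.simple t), ← ih]
    simp only [mul_assoc]

theorem mem_inv_alternating {s t : B} {k : ℕ} (hk : M s t = 0 ∨ k ≤ M s t) {x : W} :
    x ∈ (of cs (alternating cs s t k)).inv ↔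
      ∃ i < k, x = (cs.simple s * cs.simple t) ^ i * cs.simple s := by
  induction k generalizing s t x with
  | zero =>
    rw [alternating, inv_of_one]
    simp
  | succ k ih =>
    have hk' : M t s = 0 ∨ k ≤ M t s := by rw [M.symmetric t s]; omega
    have hrec : (cs.simple s)⁻¹ * x * cs.simple s ∈ (of cs (alternating cs t s k)).inv ↔
        ∃ i < k, x = (cs.simple s * cs.simple t) ^ (i + 1) * cs.simple s := by
      rw [ih hk']
      refine exists_congr fun i ↦ and_congr_right fun _ ↦ ?_
      rw [← simple_mul_simple_pow_mul_simple]
      constructor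
      · intro h; rw [← h]; simp [mul_assoc]
      · intro h; rw [h]; simp [mul_assoc]
    have hs : ¬ ∃ i < k, cs.simple s = (cs.simple s * cs.simple t) ^ (i + 1) * cs.simple s := by
      rintro ⟨i, hi, h⟩
      rw [right_eq_mul] at h
      rw [← orderOf_simple_mul_simple cs] at hk
      have := orderOf_dvd_of_pow_eq_one h
      rcases hk with hk | hk
      · rw [hk, zero_dvd_iff] at this
        omega
      · have := Nat.le_of_dvd (by omega) this
        omega
    have hmul := isLeftInversion_mul_iff cs (cs.simple s) (alternating cs t s k) x
    rw [isLeftInversion_simple_iff] at hmul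
    change _ ↔ ¬ (_ ↔ _ ∈ (of cs (alternating cs t s k)).inv) at hmul
    rw [hrec] at hmul
    refine hmul.trans ?_
    constructor
    · intro h
      by_cases hx : x = cs.simple s
      · exact ⟨0, by omega, by simpa using hx⟩
      · have : ∃ i < k, x = (cs.simple s * cs.simple t) ^ (i + 1) * cs.simple s := by tauto
        obtain ⟨i, hi, h⟩ := this
        exact ⟨i + 1, by omega, h⟩
    · rintro ⟨i, hi, rfl⟩
      obtain _ | i := i
      · simp only [pow_zero, one_mul, true_iff]
        exact hs
      · intro h
        have h2 := h.2 ⟨i, by omega, rfl⟩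
        rw [h2] at h
        exact hs (h.1 rfl)

variable {s t : B}

theorem simple_pow_mul_simple_injOn (s t : B) {i j : ℕ} (hi : i < M s t) (hj : j < M s t)
    (h : (cs.simple s * cs.simple t) ^ i * cs.simple s =
      (cs.simple s * cs.simple t) ^ j * cs.simple s) : i = j := by
  rw [← orderOf_simple_mul_simple cs] at hi hj
  exact pow_injOn_Iio_orderOf hi hj (mul_right_cancel h)

theorem simple_pow_mul_simple_swap (s t : B) {i : ℕ} (hi : i < M s t) :
    (cs.simple t * cs.simple s) ^ i * cs.simple t =
      (cs.simple s * cs.simple t) ^ (M s t - 1 - i) * cs.simple s := by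
  have h1 : cs.simple t * cs.simple s = (cs.simple s * cs.simple t)⁻¹ := by simp
  have h2 : (cs.simple s * cs.simple t) ^ (M s t - 1 - i) *
      (cs.simple s * cs.simple t) ^ (i + 1) = 1 := by
    rw [← pow_add, show M s t - 1 - i + (i + 1) = M s t by omega, cs.simple_mul_simple_pow]
  rw [eq_inv_of_mul_eq_one_left h2, h1, inv_pow, pow_succ', mul_inv_rev, mul_assoc]
  simp

theorem alternating_le_alternating {k l : ℕ} (hkl : k ≤ l) (hl : l ≤ M s t) :
    of cs (alternating cs s t k) ≤ of cs (alternating cs s t l) := by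
  intro x hx
  obtain ⟨i, hi, rfl⟩ := (mem_inv_alternating (Or.inr (hkl.trans hl))).1 hx
  exact (mem_inv_alternating (Or.inr hl)).2 ⟨i, by omega, rfl⟩

theorem alternating_injOn {k l : ℕ} (hk : k ≤ M s t) (hl : l ≤ M s t)
    (h : alternating cs s t k = alternating cs s t l) : k = l := by
  wlog hkl : k < l generalizing k l
  · rcases (not_lt.1 hkl).lt_or_eq with h' | h'
    · exact (this hl hk h.symm h').symm
    · exact h'.symm
  have h1 : (cs.simple s * cs.simple t) ^ k * cs.simple s ∈ (of cs (alternating cs s t k)).inv := by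
    rw [h]
    exact (mem_inv_alternating (Or.inr hl)).2 ⟨k, hkl, rfl⟩
  obtain ⟨i, hi, hki⟩ := (mem_inv_alternating (Or.inr hk)).1 h1
  have := simple_pow_mul_simple_injOn s t (by omega) (by omega) hki
  omega

theorem simple_mem_inv_alternating {k : ℕ} (hk : 1 ≤ k) (hk' : k ≤ M s t) :
    cs.simple s ∈ (of cs (alternating cs s t k)).inv :=
  (mem_inv_alternating (Or.inr hk')).2 ⟨0, hk, by simp⟩

theorem inv_alternating_swap_subset {k : ℕ} (hk : k ≤ M s t) :
    (of cs (alternating cs t s k)).inv ⊆ (of cs (alternating cs s t (M s t))).inv := by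
  intro x hx
  obtain ⟨i, hi, rfl⟩ := (mem_inv_alternating (Or.inr (M.symmetric s t ▸ hk))).1 hx
  rw [simple_pow_mul_simple_swap s t (by omega)]
  exact (mem_inv_alternating (Or.inr le_rfl)).2 ⟨_, by omega, rfl⟩

theorem alternating_braid (s t : B) :
    alternating cs s t (M s t) = alternating cs t s (M s t) := by
  have h1 := inv_alternating_swap_subset (cs := cs) (s := s) (t := t) le_rfl
  have h2 := inv_alternating_swap_subset (cs := cs) (s := t) (t := s) le_rfl
  rw [M.symmetric t s] at h2
  exact inv_injective (h2.antisymm h1)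

variable [Finite W]


theorem two_le_matrix (cs : CoxeterSystem M W) (hst : s ≠ t) : 2 ≤ M s t := by
  have h0 := matrix_ne_zero cs s t
  have h1 := M.off_diagonal s t hst
  omega

/-- The reflection `t` is the last one to appear among the left inversions of `s t s ⋯`. -/
theorem simple_right_mem_inv_alternating_iff {k : ℕ} (hk : k ≤ M s t) :
    cs.simple t ∈ (of cs (alternating cs s t k)).inv ↔ k = M s t := by
  have hm := Nat.pos_of_ne_zero (matrix_ne_zero cs s t)
  have ht : cs.simple t = (cs.simple s * cs.simple t) ^ (M s t - 1) * cs.simple s := by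
    have := simple_pow_mul_simple_swap (cs := cs) s t hm
    simpa using this
  rw [mem_inv_alternating (Or.inr hk)]
  constructor
  · rintro ⟨i, hi, h⟩
    have := simple_pow_mul_simple_injOn s t (by omega) (by omega) (ht.symm.trans h)
    omega
  · rintro rfl
    exact ⟨_, by omega, ht⟩

theorem exists_eq_alternating_of_mem_parabolic {w : W} (hw : w ∈ parabolic cs {s, t}) :
    ∃ k ≤ M s t, w = alternating cs s t k ∨ w = alternating cs t s k := by
  have hm := Nat.pos_of_ne_zero (matrix_ne_zero cs s t)
  have step : ∀ a ∈ cs.simple '' {s, t}, ∀ w,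
      (∃ k ≤ M s t, w = alternating cs s t k ∨ w = alternating cs t s k) →
      ∃ k ≤ M s t, a * w = alternating cs s t k ∨ a * w = alternating cs t s k := by
    have up : ∀ a b : B, M a b = M s t → ∀ k ≤ M s t, ∃ l ≤ M s t,
        cs.simple a * alternating cs b a k = alternating cs a b l ∨
          cs.simple a * alternating cs b a k = alternating cs b a l := by
      intro a b hab k hk
      rcases hk.lt_or_eq with hk | rfl
      · exact ⟨k + 1, hk, Or.inl rfl⟩
      · refine ⟨M s t - 1, by omega, Or.inr ?_⟩
        rw [← hab, ← alternating_braid]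
        obtain ⟨n, hn⟩ : ∃ n, M a b = n + 1 := ⟨M a b - 1, by omega⟩
        rw [hn, alternating, simple_mul_simple_cancel_left, Nat.add_sub_cancel]
    have down : ∀ a b : B, M a b = M s t → ∀ k ≤ M s t, ∃ l ≤ M s t,
        cs.simple a * alternating cs a b k = alternating cs a b l ∨
          cs.simple a * alternating cs a b k = alternating cs b a l := by
      intro a b hab k hk
      obtain _ | k := k
      · exact ⟨1, hm, Or.inl (by simp [alternating])⟩
      · exact ⟨k, by omega, Or.inr (by rw [alternating, simple_mul_simple_cancel_left])⟩
    rintro _ ⟨a, ha | ha, rfl⟩ w ⟨k, hk, rfl | rfl⟩ <;> subst ha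
    · exact down _ _ rfl k hk
    · exact up _ _ rfl k hk
    · obtain ⟨l, hl, h⟩ := up a s (M.symmetric _ _) k hk
      exact ⟨l, hl, h.symm⟩
    · obtain ⟨l, hl, h⟩ := down a s (M.symmetric _ _) k hk
      exact ⟨l, hl, h.symm⟩
  induction hw using Subgroup.closure_induction_left with
  | one => exact ⟨0, by omega, Or.inl rfl⟩
  | mul_left x hx y _ ih => exact step x hx y ih
  | inv_mul_cancel x hx y _ ih =>
    obtain ⟨i, hi, rfl⟩ := hx
    rw [inv_simple]
    exact step _ ⟨i, hi, rfl⟩ y ih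

/-- The alternating product of `M s t` letters is the longest element of the dihedral parabolic
subgroup. -/
theorem inv_alternating_matrix (s t : B) :
    (of cs (alternating cs s t (M s t))).inv = reflections cs {s, t} := by
  refine (inv_subset_reflections (alternating_mem_parabolic cs (by simp) (by simp) _)).antisymm ?_
  rintro x ⟨hx, hxI⟩
  have hxx : x ∈ (of cs x).inv := ⟨hx, by
    rw [of, hx.mul_self, length_one]
    exact hx.odd_length.pos⟩
  obtain ⟨k, hk, rfl | rfl⟩ := exists_eq_alternating_of_mem_parabolic hxI
  · exact alternating_le_alternating hk le_rfl _ hxx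
  · exact inv_alternating_swap_subset hk hxx

theorem eq_alternating_of_simple_mem_inv {x : WeakOrder cs} (hst : s ≠ t)
    (hx : x.inv ⊆ reflections cs {s, t}) (hs : cs.simple s ∈ x.inv) :
    ∃ k, 1 ≤ k ∧ k ≤ M s t ∧ x = of cs (alternating cs s t k) := by
  obtain ⟨w, hw, hxw⟩ := exists_mem_parabolic_of_inv_subset hx
  rw [hxw] at hs ⊢
  obtain ⟨k, hk, rfl | rfl⟩ := exists_eq_alternating_of_mem_parabolic hw
  · refine ⟨k, ?_, hk, rfl⟩
    by_contra! h0
    obtain rfl : k = 0 := by omega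
    rw [alternating, inv_of_one] at hs
    exact hs
  · rw [simple_right_mem_inv_alternating_iff (M.symmetric s t ▸ hk), M.symmetric t s] at hs
    subst hs
    exact ⟨M s t, (two_le_matrix cs hst).trans' one_le_two, le_rfl,
      congrArg (of cs) (alternating_braid s t).symm⟩

theorem inv_inter_reflections_eq_empty {x : WeakOrder cs} (hs : cs.simple s ∉ x.inv)
    (ht : cs.simple t ∉ x.inv) : x.inv ∩ reflections cs {s, t} = ∅ := by
  obtain ⟨y, hy⟩ := exists_inv_eq_inter {s, t} x
  obtain ⟨w, hw, hyw⟩ := exists_mem_parabolic_of_inv_subset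
    (hy.trans_subset Set.inter_subset_right)
  rw [hyw] at hy
  rw [← hy]
  obtain ⟨k, hk, rfl | rfl⟩ := exists_eq_alternating_of_mem_parabolic hw <;>
    rcases Nat.eq_zero_or_pos k with rfl | hk0
  · exact inv_of_one
  · have := simple_mem_inv_alternating (cs := cs) hk0 hk
    rw [hy] at this
    exact absurd this.1 hs
  · exact inv_of_one
  · have := simple_mem_inv_alternating (cs := cs) (s := t) (t := s) hk0 (M.symmetric s t ▸ hk)
    rw [hy] at this
    exact absurd this.1 ht

theorem reflections_subset_inv {x : WeakOrder cs} (hst : s ≠ t) (hs : cs.simple s ∈ x.inv)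
    (ht : cs.simple t ∈ x.inv) : reflections cs {s, t} ⊆ x.inv := by
  obtain ⟨y, hy⟩ := exists_inv_eq_inter {s, t} x
  have hmem : ∀ a ∈ ({s, t} : Set B), cs.simple a ∈ x.inv → cs.simple a ∈ y.inv := fun a ha h ↦
    hy ▸ ⟨h, cs.isReflection_simple a, (simple_mem_parabolic_iff cs).2 ha⟩
  obtain ⟨k, -, hk, rfl⟩ := eq_alternating_of_simple_mem_inv hst
    (hy.trans_subset Set.inter_subset_right) (hmem s (by simp) hs)
  have := (simple_right_mem_inv_alternating_iff hk).1 (hmem t (by simp) ht)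
  rw [← inv_alternating_matrix, ← this, hy]
  exact Set.inter_subset_left

/-- The element of length `M s t - 1` starting with `t` has every reflection of the dihedral
parabolic subgroup except `s` as a left inversion. -/
theorem inv_alternating_pred (hst : s ≠ t) :
    (of cs (alternating cs t s (M s t - 1))).inv = reflections cs {s, t} \ {cs.simple s} := by
  have hm := two_le_matrix cs hst
  have hsym := M.symmetric s t
  rw [Set.pair_comm, ← inv_alternating_matrix, hsym]
  ext x
  rw [Set.mem_sdiff, Set.mem_singleton_iff, mem_inv_alternating (Or.inr (by omega)),
    mem_inv_alternating (Or.inr le_rfl)]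
  have h0 := simple_pow_mul_simple_swap (cs := cs) t s (i := 0) (by omega)
  rw [pow_zero, one_mul] at h0
  constructor
  · rintro ⟨i, hi, rfl⟩
    refine ⟨⟨i, by omega, rfl⟩, fun h ↦ ?_⟩
    have := simple_pow_mul_simple_injOn t s (by omega) (by omega) (h.trans h0)
    omega
  · rintro ⟨⟨i, hi, rfl⟩, h⟩
    refine ⟨i, ?_, rfl⟩
    by_contra! h'
    obtain rfl : i = M t s - 1 - 0 := by omega
    exact h h0.symm

end Dihedral

open WeakOrder

/-! ### Congruences that separate elements -/

section Congruence

variable {B W : Type*} [Group W] {M : CoxeterMatrix B} {cs : CoxeterSystem M W}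

/-- Two elements are related when both or neither of them lie above the simple reflection `i`. -/
def simpleSetoid (cs : CoxeterSystem M W) (i : B) : Setoid (WeakOrder cs) where
  r x y := cs.simple i ∈ x.inv ↔ cs.simple i ∈ y.inv
  iseqv := ⟨fun _ ↦ Iff.rfl, Iff.symm, Iff.trans⟩

/-- Two elements are related when their parabolic factors with respect to `{s, t}` are equal or both
lie on the side of `t` of the polygon, strictly between its bottom and its top. The latter elements
are those with `t`, but not `s`, among their left inversions; the premise of the last clause says
that `x` is not one of them. -/
def polygonSetoid (cs : CoxeterSystem M W) (s t : B) : Setoid (WeakOrder cs) where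
  r x y := (cs.simple s ∈ x.inv ↔ cs.simple s ∈ y.inv) ∧
    (cs.simple t ∈ x.inv ↔ cs.simple t ∈ y.inv) ∧
    ((cs.simple t ∈ x.inv → cs.simple s ∈ x.inv) →
      x.inv ∩ reflections cs {s, t} = y.inv ∩ reflections cs {s, t})
  iseqv :=
    { refl := fun _ ↦ ⟨Iff.rfl, Iff.rfl, fun _ ↦ rfl⟩
      symm := fun ⟨h1, h2, h3⟩ ↦ ⟨h1.symm, h2.symm, fun h ↦ (h3 (by rwa [h1, h2])).symm⟩
      trans := fun ⟨h1, h2, h3⟩ ⟨k1, k2, k3⟩ ↦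
        ⟨h1.trans k1, h2.trans k2, fun h ↦ (h3 h).trans (k3 (by rwa [← h1, ← h2]))⟩ }

variable [Finite W]

theorem isLatticeCongruence_simpleSetoid (i : B) : IsLatticeCongruence (simpleSetoid cs i) where
  sup a₁ a₂ b₁ b₂ c₁ c₂ ha hb h₁ h₂ := by
    have ha : cs.simple i ∈ a₁.inv ↔ cs.simple i ∈ a₂.inv := ha
    have hb : cs.simple i ∈ b₁.inv ↔ cs.simple i ∈ b₂.inv := hb
    change cs.simple i ∈ c₁.inv ↔ cs.simple i ∈ c₂.inv
    rw [simple_mem_inv_of_isLUB i h₁, simple_mem_inv_of_isLUB i h₂, ha, hb]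
  inf a₁ a₂ b₁ b₂ c₁ c₂ ha hb h₁ h₂ := by
    have ha : cs.simple i ∈ a₁.inv ↔ cs.simple i ∈ a₂.inv := ha
    have hb : cs.simple i ∈ b₁.inv ↔ cs.simple i ∈ b₂.inv := hb
    change cs.simple i ∈ c₁.inv ↔ cs.simple i ∈ c₂.inv
    rw [simple_mem_inv_of_isGLB i h₁, simple_mem_inv_of_isGLB i h₂, ha, hb]

/-- If one of the arguments of a join (meet) lies on the side of `t` of the polygon, then the join
(meet) lies there as well or its parabolic factor is the top (bottom) of the polygon. -/
theorem isLatticeCongruence_polygonSetoid {s t : B} (hst : s ≠ t) :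
    IsLatticeCongruence (polygonSetoid cs s t) where
  sup a₁ a₂ b₁ b₂ c₁ c₂ ha hb h₁ h₂ := by
    obtain ⟨ha1, ha2, ha3⟩ := ha
    obtain ⟨hb1, hb2, hb3⟩ := hb
    have hs₁ := simple_mem_inv_of_isLUB s h₁
    have ht₁ := simple_mem_inv_of_isLUB t h₁
    have hs₂ := simple_mem_inv_of_isLUB s h₂
    have ht₂ := simple_mem_inv_of_isLUB t h₂
    have hs : cs.simple s ∈ c₁.inv ↔ cs.simple s ∈ c₂.inv := by rw [hs₁, hs₂, ha1, hb1]
    have ht : cs.simple t ∈ c₁.inv ↔ cs.simple t ∈ c₂.inv := by rw [ht₁, ht₂, ha2, hb2]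
    refine ⟨hs, ht, fun hc ↦ ?_⟩
    by_cases hboth : cs.simple s ∈ c₁.inv ∧ cs.simple t ∈ c₁.inv
    · rw [Set.inter_eq_right.2 (reflections_subset_inv hst hboth.1 hboth.2),
        Set.inter_eq_right.2 (reflections_subset_inv hst (hs.1 hboth.1) (ht.1 hboth.2))]
    · have ha := ha3 fun h ↦ absurd ⟨hc (ht₁.2 (Or.inl h)), ht₁.2 (Or.inl h)⟩ hboth
      have hb := hb3 fun h ↦ absurd ⟨hc (ht₁.2 (Or.inr h)), ht₁.2 (Or.inr h)⟩ hboth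
      refine Set.Subset.antisymm (Set.subset_inter ?_ Set.inter_subset_right)
        (Set.subset_inter ?_ Set.inter_subset_right)
      · exact inv_inter_subset_of_isLUB (ha.trans_subset Set.inter_subset_left)
          (hb.trans_subset Set.inter_subset_left) h₁ h₂
      · exact inv_inter_subset_of_isLUB (ha.symm.trans_subset Set.inter_subset_left)
          (hb.symm.trans_subset Set.inter_subset_left) h₂ h₁
  inf a₁ a₂ b₁ b₂ c₁ c₂ ha hb h₁ h₂ := by
    obtain ⟨ha1, ha2, ha3⟩ := ha
    obtain ⟨hb1, hb2, hb3⟩ := hb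
    have hs₁ := simple_mem_inv_of_isGLB s h₁
    have ht₁ := simple_mem_inv_of_isGLB t h₁
    have hs₂ := simple_mem_inv_of_isGLB s h₂
    have ht₂ := simple_mem_inv_of_isGLB t h₂
    have hs : cs.simple s ∈ c₁.inv ↔ cs.simple s ∈ c₂.inv := by rw [hs₁, hs₂, ha1, hb1]
    have ht : cs.simple t ∈ c₁.inv ↔ cs.simple t ∈ c₂.inv := by rw [ht₁, ht₂, ha2, hb2]
    refine ⟨hs, ht, fun hc ↦ ?_⟩
    by_cases hnone : cs.simple s ∉ c₁.inv ∧ cs.simple t ∉ c₁.inv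
    · rw [inv_inter_reflections_eq_empty hnone.1 hnone.2,
        inv_inter_reflections_eq_empty (hs.not.1 hnone.1) (ht.not.1 hnone.2)]
    · have ha := ha3 fun _ ↦ by_contra fun h ↦
        hnone ⟨fun k ↦ h (hs₁.1 k).1, fun k ↦ h (hs₁.1 (hc k)).1⟩
      have hb := hb3 fun _ ↦ by_contra fun h ↦
        hnone ⟨fun k ↦ h (hs₁.1 k).2, fun k ↦ h (hs₁.1 (hc k)).2⟩
      refine Set.Subset.antisymm (Set.subset_inter ?_ Set.inter_subset_right)
        (Set.subset_inter ?_ Set.inter_subset_right)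
      · exact inv_inter_subset_of_isGLB (ha.trans_subset Set.inter_subset_left)
          (hb.trans_subset Set.inter_subset_left) h₁ h₂
      · exact inv_inter_subset_of_isGLB (ha.symm.trans_subset Set.inter_subset_left)
          (hb.symm.trans_subset Set.inter_subset_left) h₂ h₁

end Congruence

/-! ### The Cambrian congruence -/

namespace DirectedDiagram

variable {B : Type*} {M : CoxeterMatrix B} (G : DirectedDiagram M)

variable {G} in
theorem Arrow.ne {s t : B} (h : G.Arrow s t) : s ≠ t := ((G.arrow_or_arrow_iff s t).1 (Or.inl h)).1

variable {G} in
theorem Arrow.matrix_ne_two {s t : B} (h : G.Arrow s t) : M s t ≠ 2 :=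
  ((G.arrow_or_arrow_iff s t).1 (Or.inl h)).2

/-- The opposite orientation. -/
def op : DirectedDiagram M where
  Arrow s t := G.Arrow t s
  arrow_or_arrow_iff s t := by rw [or_comm]; exact G.arrow_or_arrow_iff s t
  asymm s t h := G.asymm t s h

end DirectedDiagram

section CambrianCongruence

variable {B W : Type*} [Group W] {M : CoxeterMatrix B} {cs : CoxeterSystem M W}
  {G : DirectedDiagram M}

theorem cambrianCongruence_le {r : Setoid (WeakOrder cs)} (hr : IsLatticeCongruence r)
    (h : ∀ s t : B, G.Arrow s t →
      r (of cs (cs.simple t)) (of cs (alternating cs t s (M s t - 1)))) :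
    cambrianCongruence cs G ≤ r := by
  refine sInf_le ⟨hr, fun s t hst ↦ ?_⟩
  rw [wordProd_reverse_alternatingWord]
  exact h s t hst

theorem isLatticeCongruence_cambrianCongruence : IsLatticeCongruence (cambrianCongruence cs G) where
  sup a₁ a₂ b₁ b₂ c₁ c₂ ha hb h₁ h₂ := fun r hr ↦
    hr.1.sup a₁ a₂ b₁ b₂ c₁ c₂ (ha r hr) (hb r hr) h₁ h₂
  inf a₁ a₂ b₁ b₂ c₁ c₂ ha hb h₁ h₂ := fun r hr ↦
    hr.1.inf a₁ a₂ b₁ b₂ c₁ c₂ (ha r hr) (hb r hr) h₁ h₂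

theorem cambrianCongruence_of_arrow {s t : B} (h : G.Arrow s t) : cambrianCongruence cs G
    (of cs (cs.simple t)) (of cs (alternating cs t s (M s t - 1))) := by
  rintro r ⟨-, hr⟩
  have := hr s t h
  rwa [wordProd_reverse_alternatingWord] at this

theorem cambrianCongruence_of_le {x y z u : WeakOrder cs} (hxy : x ≤ y)
    (hyz : cambrianCongruence cs G y z) (hu : IsGLB {x, z} u) : cambrianCongruence cs G x u := by
  refine isLatticeCongruence_cambrianCongruence.inf x x y z x u (Setoid.refl' _ x) hyz ?_ hu
  refine ⟨?_, fun a ha ↦ ha (Set.mem_insert _ _)⟩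
  rintro a (rfl | rfl)
  exacts [le_rfl, hxy]

/-- Congruence classes are convex. -/
theorem cambrianCongruence_of_le_of_le {x y z : WeakOrder cs} (hzx : z ≤ x) (hxy : x ≤ y)
    (hyz : cambrianCongruence cs G y z) : cambrianCongruence cs G x z := by
  refine cambrianCongruence_of_le hxy hyz ⟨?_, fun a ha ↦ ha (Set.mem_insert_of_mem _ rfl)⟩
  rintro a (rfl | rfl)
  exacts [hzx, le_rfl]

theorem simple_mem_reflections_iff {I : Set B} {i : B} :
    cs.simple i ∈ reflections cs I ↔ i ∈ I :=
  ⟨fun h ↦ (simple_mem_parabolic_iff cs).1 h.2,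
    fun h ↦ ⟨cs.isReflection_simple i, (simple_mem_parabolic_iff cs).2 h⟩⟩

theorem simple_mem_inv_simple_iff {i j : B} :
    cs.simple i ∈ (of cs (cs.simple j)).inv ↔ i = j := by
  rw [inv_of_simple, Set.mem_singleton_iff, (simple_injective cs).eq_iff]

variable [Finite W]

theorem simple_mem_inv_alternating_pred_iff {s t : B} (hst : s ≠ t) (i : B) :
    cs.simple i ∈ (of cs (alternating cs t s (M s t - 1))).inv ↔ i = t := by
  rw [inv_alternating_pred hst, Set.mem_sdiff, simple_mem_reflections_iff,
    Set.mem_singleton_iff, (simple_injective cs).eq_iff]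
  simp only [Set.mem_insert_iff, Set.mem_singleton_iff]
  have : i = t → i ≠ s := by rintro rfl; exact hst.symm
  tauto

theorem simple_mem_inv_iff_of_cambrianCongruence {x y : WeakOrder cs}
    (h : cambrianCongruence cs G x y) (i : B) : cs.simple i ∈ x.inv ↔ cs.simple i ∈ y.inv := by
  refine cambrianCongruence_le (isLatticeCongruence_simpleSetoid i) (fun s t hst ↦ ?_) h
  change _ ∈ (of cs _).inv ↔ _ ∈ (of cs _).inv
  rw [simple_mem_inv_simple_iff, simple_mem_inv_alternating_pred_iff hst.ne]

/-- On the source side of the polygon of an edge `s → t` the Cambrian congruence identifies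
nothing. -/
theorem inv_inter_eq_of_cambrianCongruence {s t : B} (hst : G.Arrow s t) {x y : WeakOrder cs}
    (h : cambrianCongruence cs G x y) (hs : cs.simple s ∈ x.inv) :
    x.inv ∩ reflections cs {s, t} = y.inv ∩ reflections cs {s, t} := by
  suffices hle : cambrianCongruence cs G ≤ polygonSetoid cs s t from (hle h).2.2 fun _ ↦ hs
  refine cambrianCongruence_le (isLatticeCongruence_polygonSetoid hst.ne) fun a b hab ↦ ?_
  have hflag : ∀ i, cs.simple i ∈ (of cs (cs.simple b)).inv ↔
      cs.simple i ∈ (of cs (alternating cs b a (M a b - 1))).inv := fun i ↦ by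
    rw [simple_mem_inv_simple_iff, simple_mem_inv_alternating_pred_iff hab.ne]
  refine ⟨hflag s, hflag t, fun hnot ↦ ?_⟩
  rw [simple_mem_inv_simple_iff, simple_mem_inv_simple_iff] at hnot
  have hbt : t ≠ b := fun h ↦ hst.ne ((hnot h).trans h.symm)
  by_cases hbs : s = b
  · subst hbs
    have hta : t ≠ a := fun h ↦ G.asymm s t hst (h ▸ hab)
    -- A second reflection `s t s` of the polygon would force `t` into the parabolic subgroup of
    -- `{a, s}`.
    obtain ⟨y, hy⟩ := exists_inv_eq_inter {s, t} (of cs (alternating cs s a (M a s - 1)))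
    have hsy : cs.simple s ∈ y.inv := by
      rw [hy]
      exact ⟨(simple_mem_inv_alternating_pred_iff hab.ne s).2 rfl,
        simple_mem_reflections_iff.2 (by simp)⟩
    obtain ⟨k, hk1, hk, rfl⟩ := eq_alternating_of_simple_mem_inv hst.ne
      (hy.trans_subset Set.inter_subset_right) hsy
    have hk2 : k = 1 := by
      by_contra hne
      have h1 : (cs.simple s * cs.simple t) ^ 1 * cs.simple s ∈
          (of cs (alternating cs s t k)).inv :=
        (mem_inv_alternating (Or.inr hk)).2 ⟨1, by omega, rfl⟩
      rw [hy] at h1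
      have h2 := mem_parabolic_of_isLeftInversion cs
        (alternating_mem_parabolic cs (I := {s, a}) (by simp) (by simp) _) h1.1
      have hs : cs.simple s ∈ parabolic cs {s, a} := (simple_mem_parabolic_iff cs).2 (by simp)
      rw [pow_one, Subgroup.mul_mem_cancel_right _ hs, Subgroup.mul_mem_cancel_left _ hs,
        simple_mem_parabolic_iff] at h2
      rcases h2 with h2 | h2
      exacts [hst.ne h2.symm, hta h2]
    rw [← hy, hk2, alternating_one, inv_of_simple, Set.inter_eq_left, Set.singleton_subset_iff]
    exact simple_mem_reflections_iff.2 (by simp)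
  · rw [inv_inter_reflections_eq_empty, inv_inter_reflections_eq_empty]
    · rwa [← hflag, simple_mem_inv_simple_iff]
    · rwa [← hflag, simple_mem_inv_simple_iff]
    · rwa [simple_mem_inv_simple_iff]
    · rwa [simple_mem_inv_simple_iff]

end CambrianCongruence

/-! ### The order of the Cambrian lattice -/

namespace CambrianLattice

variable {B W : Type*} [Group W] {M : CoxeterMatrix B} {cs : CoxeterSystem M W}
  {G : DirectedDiagram M}

theorem mk_eq_mk_iff {x y : WeakOrder cs} :
    mk cs G x = mk cs G y ↔ cambrianCongruence cs G x y := Quotient.eq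

theorem mk_le_mk {x y : WeakOrder cs} (h : x ≤ y) : mk cs G x ≤ mk cs G y := ⟨x, y, rfl, rfl, h⟩

theorem exists_mk_eq (p : CambrianLattice cs G) : ∃ x : WeakOrder cs, mk cs G x = p :=
  Quotient.exists_rep p

theorem mk_one_le (p : CambrianLattice cs G) : mk cs G 1 ≤ p := by
  obtain ⟨x, rfl⟩ := exists_mk_eq p
  exact mk_le_mk (x := of cs 1) (le_iff.2 (inv_of_one.trans_subset (Set.empty_subset _)))

/-- The class of the longest element of the parabolic subgroup of `{s, t}`. -/
def top (cs : CoxeterSystem M W) (G : DirectedDiagram M) (s t : B) : CambrianLattice cs G :=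
  mk cs G (alternating cs s t (M s t))

variable [Finite W]

theorem mk_simple_le_iff {i : B} {x : WeakOrder cs} :
    mk cs G (cs.simple i) ≤ mk cs G x ↔ cs.simple i ∈ x.inv := by
  constructor
  · rintro ⟨a, b, ha, hb, hab⟩
    rw [← simple_mem_inv_iff_of_cambrianCongruence (mk_eq_mk_iff.1 hb)]
    refine hab _ ((simple_mem_inv_iff_of_cambrianCongruence (mk_eq_mk_iff.1 ha) i).2 ?_)
    exact simple_mem_inv_simple_iff.2 rfl
  · intro h
    exact mk_le_mk (x := of cs (cs.simple i)) (of_simple_le_iff.2 h)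

theorem eq_mk_one_of_le {p : CambrianLattice cs G} (h : p ≤ mk cs G 1) : p = mk cs G 1 := by
  obtain ⟨a, b, rfl, hb, hab⟩ := h
  by_contra hne
  obtain ⟨i, hi⟩ := exists_simple_mem_inv (x := a) (fun h ↦ hne (congrArg _ h))
  have := (simple_mem_inv_iff_of_cambrianCongruence (y := of cs 1) (mk_eq_mk_iff.1 hb) i).1 (hab _ hi)
  rw [inv_of_one] at this
  exact this

theorem mk_simple_ne_mk_one (i : B) : mk cs G (cs.simple i) ≠ mk cs G 1 := by
  intro h
  have := (mk_simple_le_iff (G := G) (i := i) (x := of cs 1)).1 ⟨_, _, h.symm, rfl, le_rfl⟩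
  rw [inv_of_one] at this
  exact this

theorem mk_simple_le_mk_simple_iff {i j : B} :
    mk cs G (cs.simple i) ≤ mk cs G (cs.simple j) ↔ i = j :=
  (mk_simple_le_iff (x := of cs (cs.simple j))).trans simple_mem_inv_simple_iff

theorem mk_simple_injective : Function.Injective fun i ↦ mk cs G (cs.simple i) := by
  intro i j (h : mk cs G (cs.simple i) = mk cs G (cs.simple j))
  rw [← mk_simple_le_mk_simple_iff (cs := cs) (G := G), ← h]
  exact mk_le_mk (x := of cs (cs.simple i)) le_rfl

/-- The classes of the simple reflections are precisely the atoms. -/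
theorem exists_eq_mk_simple_iff {p : CambrianLattice cs G} :
    (∃ i, p = mk cs G (cs.simple i)) ↔
      p ≠ mk cs G 1 ∧ ∀ q, q ≤ p → q = mk cs G 1 ∨ q = p := by
  constructor
  · rintro ⟨i, rfl⟩
    refine ⟨mk_simple_ne_mk_one i, ?_⟩
    rintro _ ⟨a, b, rfl, hb, hab⟩
    by_cases ha : a = of cs 1
    · exact Or.inl (congrArg _ ha)
    · obtain ⟨j, hj⟩ := exists_simple_mem_inv ha
      have hb := mk_eq_mk_iff (y := of cs (cs.simple i)) |>.1 hb
      have hji := (simple_mem_inv_iff_of_cambrianCongruence hb j).1 (hab _ hj)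
      rw [simple_mem_inv_simple_iff] at hji
      subst hji
      exact Or.inr (mk_eq_mk_iff.2
        (cambrianCongruence_of_le_of_le (of_simple_le_iff.2 hj) hab hb))
  · rintro ⟨hp, h⟩
    obtain ⟨x, rfl⟩ := exists_mk_eq p
    obtain ⟨i, hi⟩ := exists_simple_mem_inv (x := x) (fun h ↦ hp (congrArg _ h))
    exact ⟨i, ((h _ (mk_simple_le_iff.2 hi)).resolve_left (mk_simple_ne_mk_one i)).symm⟩

section Polygon

variable {s t : B}

theorem top_le_mk_iff (hst : s ≠ t) {x : WeakOrder cs} :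
    top cs G s t ≤ mk cs G x ↔ cs.simple s ∈ x.inv ∧ cs.simple t ∈ x.inv := by
  constructor
  · rintro ⟨a, b, ha, hb, hab⟩
    have ha := simple_mem_inv_iff_of_cambrianCongruence
      (mk_eq_mk_iff (y := of cs (alternating cs s t (M s t))) |>.1 ha)
    have hb := simple_mem_inv_iff_of_cambrianCongruence (mk_eq_mk_iff.1 hb)
    rw [inv_alternating_matrix] at ha
    exact ⟨(hb s).1 (hab _ ((ha s).2 (simple_mem_reflections_iff.2 (by simp)))),
      (hb t).1 (hab _ ((ha t).2 (simple_mem_reflections_iff.2 (by simp))))⟩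
  · rintro ⟨hs, ht⟩
    exact mk_le_mk (x := of cs (alternating cs s t (M s t)))
      (le_iff.2 (inv_alternating_matrix (cs := cs) s t ▸ reflections_subset_inv hst hs ht))

theorem top_le_iff (hst : s ≠ t) {p : CambrianLattice cs G} :
    top cs G s t ≤ p ↔ mk cs G (cs.simple s) ≤ p ∧ mk cs G (cs.simple t) ≤ p := by
  obtain ⟨x, rfl⟩ := exists_mk_eq p
  rw [top_le_mk_iff hst, mk_simple_le_iff, mk_simple_le_iff]

theorem eq_top_of_le_of_le (hst : s ≠ t) {p : CambrianLattice cs G} (h₁ : top cs G s t ≤ p)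
    (h₂ : p ≤ top cs G s t) : p = top cs G s t := by
  obtain ⟨a, b, rfl, hb, hab⟩ := h₂
  obtain ⟨hs, ht⟩ := (top_le_mk_iff hst).1 h₁
  refine mk_eq_mk_iff (y := of cs (alternating cs s t (M s t))) |>.2
    (cambrianCongruence_of_le_of_le ?_ hab (mk_eq_mk_iff.1 hb))
  exact le_iff.2 (inv_alternating_matrix (cs := cs) s t ▸ reflections_subset_inv hst hs ht)

/-- The side of the polygon of `{s, t}` that contains `s`: the interval from `s` to the join of `s`
and `t` in the Cambrian lattice. -/
def side (cs : CoxeterSystem M W) (G : DirectedDiagram M) (s t : B) : Set (CambrianLattice cs G) :=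
  {q | mk cs G (cs.simple s) ≤ q ∧ q ≤ top cs G s t}

theorem side_eq_image (hst : s ≠ t) :
    side cs G s t = (fun k ↦ mk cs G (alternating cs s t k)) '' Set.Icc 1 (M s t) := by
  ext q
  constructor
  · rintro ⟨hq, a, b, rfl, hb, hab⟩
    rw [mk_simple_le_iff] at hq
    obtain ⟨u, hu⟩ := exists_inv_eq_inter {s, t} a
    have hau : cambrianCongruence cs G a u := by
      refine cambrianCongruence_of_le hab
        (mk_eq_mk_iff (y := of cs (alternating cs s t (M s t))) |>.1 hb) (isGLB_of_inv_eq ?_)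
      rw [hu, inv_alternating_matrix]
    obtain ⟨k, hk1, hk, rfl⟩ := eq_alternating_of_simple_mem_inv hst
      (hu.trans_subset Set.inter_subset_right)
      (hu ▸ ⟨hq, simple_mem_reflections_iff.2 (by simp)⟩)
    exact ⟨k, ⟨hk1, hk⟩, (mk_eq_mk_iff.2 hau).symm⟩
  · rintro ⟨k, ⟨hk1, hk⟩, rfl⟩
    exact ⟨mk_simple_le_iff (x := of cs (alternating cs s t k)) |>.2
      (simple_mem_inv_alternating hk1 hk),
      mk_le_mk (x := of cs (alternating cs s t k)) (y := of cs (alternating cs s t (M s t)))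
        (alternating_le_alternating hk le_rfl)⟩

theorem ncard_side_of_arrow (hst : G.Arrow s t) : (side cs G s t).ncard = M s t := by
  rw [side_eq_image hst.ne, Set.InjOn.ncard_image]
  · rw [← Finset.coe_Icc, Set.ncard_coe_finset, Nat.card_Icc, Nat.add_sub_cancel]
  · rintro k ⟨hk1, hk⟩ l ⟨hl1, hl⟩ hkl
    have h := inv_inter_eq_of_cambrianCongruence hst
      (mk_eq_mk_iff (x := of cs (alternating cs s t k)) (y := of cs (alternating cs s t l)) |>.1 hkl)
      (simple_mem_inv_alternating hk1 hk)
    have hsub : ∀ k, (of cs (alternating cs s t k)).inv ⊆ reflections cs {s, t} := fun k ↦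
      inv_subset_reflections (alternating_mem_parabolic cs (by simp) (by simp) k)
    rw [Set.inter_eq_left.2 (hsub k), Set.inter_eq_left.2 (hsub l)] at h
    exact alternating_injOn (cs := cs) hk hl (inv_injective h)

theorem ncard_side_of_not_arrow (hne : s ≠ t) (hst : ¬ G.Arrow s t) :
    (side cs G s t).ncard = 2 := by
  have hm := two_le_matrix cs hne
  have hmk : ∀ k, 1 ≤ k → k < M s t →
      mk cs G (alternating cs s t k) = mk cs G (cs.simple s) := by
    intro k hk1 hk
    by_cases hts : G.Arrow t s
    · have hgen := cambrianCongruence_of_arrow (cs := cs) hts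
      rw [M.symmetric t s] at hgen
      exact mk_eq_mk_iff (x := of cs (alternating cs s t k)) (y := of cs (cs.simple s)) |>.2
        (cambrianCongruence_of_le_of_le (of_simple_le_iff.2 (simple_mem_inv_alternating hk1 hk.le))
          (alternating_le_alternating (by omega) (by omega)) (Setoid.symm' _ hgen))
    · have h2 : M s t = 2 := by
        by_contra h2
        exact ((G.arrow_or_arrow_iff s t).2 ⟨hne, h2⟩).elim hst hts
      obtain rfl : k = 1 := by omega
      rw [alternating_one]
  have hpair : side cs G s t = {mk cs G (cs.simple s), top cs G s t} := by
    rw [side_eq_image hne]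
    ext q
    constructor
    · rintro ⟨k, ⟨hk1, hk⟩, rfl⟩
      rcases hk.lt_or_eq with hk | rfl
      · exact Or.inl (hmk k hk1 hk)
      · exact Or.inr rfl
    · rintro (rfl | rfl)
      · exact ⟨1, ⟨le_rfl, by omega⟩, hmk 1 le_rfl (by omega)⟩
      · exact ⟨M s t, ⟨by omega, le_rfl⟩, rfl⟩
  rw [hpair, Set.ncard_pair]
  intro h
  have h1 := (top_le_iff (cs := cs) (G := G) hne (p := mk cs G (cs.simple s))).1
    (h ▸ mk_le_mk (x := of cs (cs.simple s)) le_rfl)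
  exact hne (mk_simple_le_mk_simple_iff.1 h1.2).symm

end Polygon

/-! ### Isomorphisms of Cambrian lattices -/

section Iso

variable {B' W' : Type*} [Group W'] [Finite W'] {M' : CoxeterMatrix B'}
  {cs' : CoxeterSystem M' W'} {G' : DirectedDiagram M'}

omit [Finite W] in
theorem map_mk_one (F : CambrianLattice cs G ≃o CambrianLattice cs' G') :
    F (mk cs G 1) = mk cs' G' 1 := by
  refine eq_mk_one_of_le ?_
  have := F.map_rel_iff.2 (mk_one_le (F.symm (mk cs' G' 1)))
  rwa [F.apply_symm_apply] at this

theorem exists_map_mk_simple (F : CambrianLattice cs G ≃o CambrianLattice cs' G') (i : B) :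
    ∃ j, F (mk cs G (cs.simple i)) = mk cs' G' (cs'.simple j) := by
  rw [exists_eq_mk_simple_iff]
  obtain ⟨h1, h2⟩ := exists_eq_mk_simple_iff.1 ⟨i, (rfl : mk cs G (cs.simple i) = _)⟩
  refine ⟨fun h ↦ h1 (F.injective (h.trans (map_mk_one F).symm)), fun q hq ↦ ?_⟩
  obtain ⟨p, rfl⟩ := F.surjective q
  rw [F.map_rel_iff] at hq
  rw [← map_mk_one F, F.injective.eq_iff, F.injective.eq_iff]
  exact h2 p hq

theorem exists_equiv_map_mk_simple (F : CambrianLattice cs G ≃o CambrianLattice cs' G') :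
    ∃ φ : B ≃ B', ∀ i, F (mk cs G (cs.simple i)) = mk cs' G' (cs'.simple (φ i)) := by
  choose φ hφ using exists_map_mk_simple F
  choose ψ hψ using exists_map_mk_simple F.symm
  refine ⟨⟨φ, ψ, fun i ↦ ?_, fun j ↦ ?_⟩, hφ⟩
  · apply mk_simple_injective (cs := cs) (G := G)
    dsimp only
    rw [← hψ, ← hφ, F.symm_apply_apply]
  · apply mk_simple_injective (cs := cs') (G := G')
    dsimp only
    rw [← hφ, ← hψ, F.apply_symm_apply]

theorem map_top (F : CambrianLattice cs G ≃o CambrianLattice cs' G') {φ : B ≃ B'}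
    (hφ : ∀ i, F (mk cs G (cs.simple i)) = mk cs' G' (cs'.simple (φ i))) {s t : B} (hst : s ≠ t) :
    F (top cs G s t) = top cs' G' (φ s) (φ t) := by
  have hst' : φ s ≠ φ t := φ.injective.ne hst
  refine eq_top_of_le_of_le hst' ((top_le_iff hst').2 ?_) ?_
  · rw [← hφ, ← hφ, F.map_rel_iff, F.map_rel_iff, ← top_le_iff hst]
    exact mk_le_mk (x := of cs _) le_rfl
  · obtain ⟨p, hp⟩ := F.surjective (top cs' G' (φ s) (φ t))
    rw [← hp, F.map_rel_iff, top_le_iff hst, ← F.map_rel_iff, ← F.map_rel_iff (a := mk _ _ _), hφ,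
      hφ, hp, ← top_le_iff hst']
    exact mk_le_mk (x := of cs' _) le_rfl

theorem ncard_side_map (F : CambrianLattice cs G ≃o CambrianLattice cs' G') {φ : B ≃ B'}
    (hφ : ∀ i, F (mk cs G (cs.simple i)) = mk cs' G' (cs'.simple (φ i))) {s t : B} (hst : s ≠ t) :
    (side cs' G' (φ s) (φ t)).ncard = (side cs G s t).ncard := by
  rw [← Set.ncard_image_of_injective _ F.injective]
  congr 1
  ext q
  obtain ⟨p, rfl⟩ := F.surjective q
  rw [F.injective.mem_set_image]
  change (_ ≤ _ ∧ _ ≤ _) ↔ (_ ≤ _ ∧ _ ≤ _)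
  rw [← hφ, ← map_top F hφ hst, F.map_rel_iff, F.map_rel_iff]

/-- An isomorphism of Cambrian lattices restricts on the atoms to an isomorphism of directed
diagrams: an edge `s → t` is recognized, together with its label, by the number of elements on the
side of `s` of the polygon spanned by `s` and `t`. -/
theorem isIso_of_map_mk_simple (F : CambrianLattice cs G ≃o CambrianLattice cs' G') {φ : B ≃ B'}
    (hφ : ∀ i, F (mk cs G (cs.simple i)) = mk cs' G' (cs'.simple (φ i))) : G.IsIso G' φ := by
  have harrow : ∀ s t, G.Arrow s t ↔ G'.Arrow (φ s) (φ t) := by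
    intro s t
    by_cases hne : s = t
    · subst hne
      exact iff_of_false (fun h ↦ h.ne rfl) (fun h ↦ h.ne rfl)
    have hne' : φ s ≠ φ t := φ.injective.ne hne
    have hside := ncard_side_map F hφ hne
    constructor
    · intro h
      by_contra h'
      rw [ncard_side_of_arrow h, ncard_side_of_not_arrow hne' h'] at hside
      exact h.matrix_ne_two hside.symm
    · intro h
      by_contra h'
      rw [ncard_side_of_arrow h, ncard_side_of_not_arrow hne h'] at hside
      exact h.matrix_ne_two hside
  refine ⟨harrow, fun s t hst ↦ ?_⟩
  have := ncard_side_map F hφ hst.ne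
  rwa [ncard_side_of_arrow hst, ncard_side_of_arrow ((harrow s t).1 hst)] at this

theorem existsUnique_isIso (F : CambrianLattice cs G ≃o CambrianLattice cs' G') :
    ∃! φ : B ≃ B', G.IsIso G' φ ∧
      ∀ i, F (mk cs G (cs.simple i)) = mk cs' G' (cs'.simple (φ i)) := by
  obtain ⟨φ, hφ⟩ := exists_equiv_map_mk_simple F
  refine ⟨φ, ⟨isIso_of_map_mk_simple F hφ, hφ⟩, fun ψ ⟨_, hψ⟩ ↦ Equiv.ext fun i ↦ ?_⟩
  exact mk_simple_injective (cs := cs') (G := G') ((hψ i).symm.trans (hφ i))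

end Iso

end CambrianLattice

/-! ### Transport along isomorphisms and anti-isomorphisms of the weak order -/

section Transport

variable {B W B' W' : Type*} [Group W] [Group W'] {M : CoxeterMatrix B} {M' : CoxeterMatrix B'}
  {cs : CoxeterSystem M W} {cs' : CoxeterSystem M' W'} {G : DirectedDiagram M}
  {G' : DirectedDiagram M'}

theorem IsLatticeCongruence.comap_orderIso {L L' : Type*} [Preorder L] [Preorder L']
    {r : Setoid L'} (hr : IsLatticeCongruence r) (e : L ≃o L') :
    IsLatticeCongruence (r.comap e) where
  sup a₁ a₂ b₁ b₂ c₁ c₂ ha hb h₁ h₂ := by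
    refine hr.sup (e a₁) (e a₂) (e b₁) (e b₂) (e c₁) (e c₂) ha hb ?_ ?_
    · simpa [Set.image_pair] using (e.isLUB_image' (s := {a₁, b₁})).2 h₁
    · simpa [Set.image_pair] using (e.isLUB_image' (s := {a₂, b₂})).2 h₂
  inf a₁ a₂ b₁ b₂ c₁ c₂ ha hb h₁ h₂ := by
    refine hr.inf (e a₁) (e a₂) (e b₁) (e b₂) (e c₁) (e c₂) ha hb ?_ ?_
    · simpa [Set.image_pair] using (e.isGLB_image' (s := {a₁, b₁})).2 h₁
    · simpa [Set.image_pair] using (e.isGLB_image' (s := {a₂, b₂})).2 h₂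

theorem IsLatticeCongruence.dual {L : Type*} [Preorder L] {r : Setoid L}
    (hr : IsLatticeCongruence r) :
    IsLatticeCongruence (r.comap (OrderDual.ofDual : Lᵒᵈ → L)) where
  sup _ _ _ _ _ _ ha hb h₁ h₂ := hr.inf _ _ _ _ _ _ ha hb h₁.dual h₂.dual
  inf _ _ _ _ _ _ ha hb h₁ h₂ := hr.sup _ _ _ _ _ _ ha hb h₁.dual h₂.dual

namespace CambrianLattice

/-- An isomorphism of weak orders that respects the Cambrian congruences induces an isomorphism of
Cambrian lattices. -/
def congr (e : WeakOrder cs ≃o WeakOrder cs')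
    (he : ∀ x y, cambrianCongruence cs G x y ↔ cambrianCongruence cs' G' (e x) (e y)) :
    CambrianLattice cs G ≃o CambrianLattice cs' G' where
  toEquiv := Quotient.congr e.toEquiv he
  map_rel_iff' := by
    intro p q
    obtain ⟨a, rfl⟩ := exists_mk_eq p
    obtain ⟨b, rfl⟩ := exists_mk_eq q
    constructor
    · rintro ⟨x, y, hx, hy, hxy⟩
      refine ⟨e.symm x, e.symm y, ?_, ?_, e.symm.monotone hxy⟩
      · rw [mk_eq_mk_iff, he, e.apply_symm_apply]
        exact mk_eq_mk_iff.1 hx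
      · rw [mk_eq_mk_iff, he, e.apply_symm_apply]
        exact mk_eq_mk_iff.1 hy
    · rintro ⟨x, y, hx, hy, hxy⟩
      exact ⟨e x, e y, mk_eq_mk_iff.2 ((he _ _).1 (mk_eq_mk_iff.1 hx)),
        mk_eq_mk_iff.2 ((he _ _).1 (mk_eq_mk_iff.1 hy)), e.monotone hxy⟩

/-- An anti-isomorphism of weak orders that respects the Cambrian congruences induces an
anti-isomorphism of Cambrian lattices. -/
def dualCongr (e : WeakOrder cs ≃o (WeakOrder cs')ᵒᵈ)
    (he : ∀ x y, cambrianCongruence cs G x y ↔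
      cambrianCongruence cs' G' (OrderDual.ofDual (e x)) (OrderDual.ofDual (e y))) :
    CambrianLattice cs G ≃o (CambrianLattice cs' G')ᵒᵈ where
  toEquiv := (Quotient.congr (e.toEquiv.trans OrderDual.ofDual) he).trans OrderDual.toDual
  map_rel_iff' := by
    intro p q
    obtain ⟨a, rfl⟩ := exists_mk_eq p
    obtain ⟨b, rfl⟩ := exists_mk_eq q
    constructor
    · rintro ⟨y, x, hy, hx, hxy⟩
      refine ⟨e.symm (OrderDual.toDual x), e.symm (OrderDual.toDual y), ?_, ?_,
        e.symm.monotone hxy⟩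
      · rw [mk_eq_mk_iff, he, e.apply_symm_apply]
        exact mk_eq_mk_iff.1 hx
      · rw [mk_eq_mk_iff, he, e.apply_symm_apply]
        exact mk_eq_mk_iff.1 hy
    · rintro ⟨x, y, hx, hy, hxy⟩
      exact ⟨OrderDual.ofDual (e y), OrderDual.ofDual (e x),
        mk_eq_mk_iff.2 ((he _ _).1 (mk_eq_mk_iff.1 hy)),
        mk_eq_mk_iff.2 ((he _ _).1 (mk_eq_mk_iff.1 hx)), e.monotone hxy⟩

end CambrianLattice

/-! ### The isomorphism of Coxeter groups induced by an isomorphism of diagrams -/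

/-- A bijection of the simple reflections that preserves the Coxeter matrix extends to the
groups. -/
theorem exists_mulEquiv (cs : CoxeterSystem M W) (cs' : CoxeterSystem M' W') (φ : B ≃ B')
    (h : ∀ s t, M' (φ s) (φ t) = M s t) :
    ∃ f : W ≃* W', ∀ s, f (cs.simple s) = cs'.simple (φ s) := by
  have h1 : M.IsLiftable (cs'.simple ∘ φ) := fun s t ↦ by
    rw [← h, Function.comp_apply, Function.comp_apply, cs'.simple_mul_simple_pow]
  have h2 : M'.IsLiftable (cs.simple ∘ φ.symm) := fun s t ↦ by
    rw [Function.comp_apply, Function.comp_apply, ← φ.apply_symm_apply s, ← φ.apply_symm_apply t, h,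
      φ.symm_apply_apply, φ.symm_apply_apply, cs.simple_mul_simple_pow]
  refine ⟨MonoidHom.toMulEquiv (cs.lift ⟨_, h1⟩) (cs'.lift ⟨_, h2⟩) ?_ ?_, fun s ↦ ?_⟩
  · exact cs.ext_simple fun s ↦ by simp
  · exact cs'.ext_simple fun s ↦ by simp
  · simp

theorem length_map_le (f : W ≃* W') {φ : B ≃ B'} (hf : ∀ s, f (cs.simple s) = cs'.simple (φ s))
    (w : W) : cs'.length (f w) ≤ cs.length w := by
  obtain ⟨ω, hω, rfl⟩ := cs.exists_isReduced w
  have : f (cs.wordProd ω) = cs'.wordProd (ω.map φ) := by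
    simp [wordProd, map_list_prod, Function.comp_def, hf]
  rw [this, hω.eq, ← List.length_map (f := φ)]
  exact cs'.length_wordProd_le _

theorem symm_map_simple {f : W ≃* W'} {φ : B ≃ B'} (hf : ∀ s, f (cs.simple s) = cs'.simple (φ s))
    (s : B') : f.symm (cs'.simple s) = cs.simple (φ.symm s) := by
  rw [MulEquiv.symm_apply_eq, hf, φ.apply_symm_apply]

theorem length_map (f : W ≃* W') {φ : B ≃ B'} (hf : ∀ s, f (cs.simple s) = cs'.simple (φ s))
    (w : W) : cs'.length (f w) = cs.length w := by
  refine (length_map_le f hf w).antisymm ?_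
  simpa using length_map_le f.symm (symm_map_simple hf) (f w)

theorem isReflection_map {f : W ≃* W'} {φ : B ≃ B'}
    (hf : ∀ s, f (cs.simple s) = cs'.simple (φ s)) {t : W} (ht : cs.IsReflection t) :
    cs'.IsReflection (f t) := by
  obtain ⟨w, i, rfl⟩ := ht
  exact ⟨f w, φ i, by simp [hf]⟩

theorem isLeftInversion_map_iff (f : W ≃* W') {φ : B ≃ B'}
    (hf : ∀ s, f (cs.simple s) = cs'.simple (φ s)) (w t : W) :
    cs'.IsLeftInversion (f w) (f t) ↔ cs.IsLeftInversion w t := by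
  have hr : cs'.IsReflection (f t) ↔ cs.IsReflection t :=
    ⟨fun h ↦ by simpa using isReflection_map (symm_map_simple hf) h, isReflection_map hf⟩
  rw [IsLeftInversion, IsLeftInversion, ← map_mul, length_map f hf, length_map f hf, hr]

/-- The isomorphism of weak orders given by an isomorphism of Coxeter systems. -/
def weakOrderCongr (f : W ≃* W') {φ : B ≃ B'} (hf : ∀ s, f (cs.simple s) = cs'.simple (φ s)) :
    WeakOrder cs ≃o WeakOrder cs' where
  toEquiv := f.toEquiv
  map_rel_iff' := by
    intro x y
    constructor
    · intro h t ht
      exact (isLeftInversion_map_iff f hf y t).1 (h _ ((isLeftInversion_map_iff f hf x t).2 ht))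
    · intro h t ht
      obtain ⟨t, rfl⟩ := f.surjective t
      exact (isLeftInversion_map_iff f hf y t).2 (h _ ((isLeftInversion_map_iff f hf x t).1 ht))

theorem map_alternating (f : W ≃* W') {φ : B ≃ B'} (hf : ∀ s, f (cs.simple s) = cs'.simple (φ s))
    (s t : B) (k : ℕ) : f (alternating cs s t k) = alternating cs' (φ s) (φ t) k := by
  induction k generalizing s t with
  | zero => exact map_one f
  | succ k ih => rw [alternating, alternating, map_mul, hf, ih]

theorem cambrianCongruence_map (f : W ≃* W') {φ : B ≃ B'}
    (hf : ∀ s, f (cs.simple s) = cs'.simple (φ s)) (hφ : G.IsIso G' φ) {x y : WeakOrder cs}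
    (h : cambrianCongruence cs G x y) :
    cambrianCongruence cs' G' (weakOrderCongr f hf x) (weakOrderCongr f hf y) := by
  refine cambrianCongruence_le ((isLatticeCongruence_cambrianCongruence (G := G')).comap_orderIso
    (weakOrderCongr f hf)) (fun s t hst ↦ ?_) h
  have := cambrianCongruence_of_arrow (cs := cs') ((hφ.1 s t).1 hst)
  rw [hφ.2 s t hst, ← hf, ← map_alternating f hf] at this
  exact this

namespace DirectedDiagram

theorem IsIso.matrix_eq {φ : B ≃ B'} (hφ : G.IsIso G' φ) (s t : B) : M' (φ s) (φ t) = M s t := by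
  by_cases hst : s = t
  · simp [hst]
  by_cases h1 : G.Arrow s t
  · exact hφ.2 s t h1
  by_cases h2 : G.Arrow t s
  · rw [M.symmetric, M'.symmetric]
    exact hφ.2 t s h2
  have h : M s t = 2 := by
    by_contra h
    exact ((G.arrow_or_arrow_iff s t).2 ⟨hst, h⟩).elim h1 h2
  rw [h]
  by_contra h'
  rw [hφ.1] at h1 h2
  exact ((G'.arrow_or_arrow_iff _ _).2 ⟨φ.injective.ne hst, h'⟩).elim h1 h2

theorem IsIso.symm {φ : B ≃ B'} (hφ : G.IsIso G' φ) : G'.IsIso G φ.symm := by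
  have h : ∀ s t, G'.Arrow s t ↔ G.Arrow (φ.symm s) (φ.symm t) := fun s t ↦ by
    rw [hφ.1, φ.apply_symm_apply, φ.apply_symm_apply]
  refine ⟨h, fun s t hst ↦ ?_⟩
  rw [← hφ.2 _ _ ((h s t).1 hst), φ.apply_symm_apply, φ.apply_symm_apply]

end DirectedDiagram

theorem exists_orderIso_of_isIso (cs : CoxeterSystem M W) (cs' : CoxeterSystem M' W') {φ : B ≃ B'}
    (hφ : G.IsIso G' φ) :
    ∃ f : W ≃* W', (∀ s, f (cs.simple s) = cs'.simple (φ s)) ∧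
      ∃ F : CambrianLattice cs G ≃o CambrianLattice cs' G',
        ∀ w : W, F (CambrianLattice.mk cs G w) = CambrianLattice.mk cs' G' (f w) := by
  obtain ⟨f, hf⟩ := exists_mulEquiv cs cs' φ hφ.matrix_eq
  refine ⟨f, hf, CambrianLattice.congr (weakOrderCongr f hf)
    fun x y ↦ ⟨cambrianCongruence_map f hf hφ, fun h ↦ ?_⟩, fun w ↦ rfl⟩
  have := cambrianCongruence_map f.symm (symm_map_simple hf) hφ.symm h
  have hs : ∀ z : WeakOrder cs, weakOrderCongr f.symm (symm_map_simple hf)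
      (weakOrderCongr f hf z) = z := fun z ↦ f.symm_apply_apply z
  rwa [hs, hs] at this

/-! ### Reversing the orientation -/

section Opposite

variable [Finite W]

theorem inv_of_mul_longest (w : W) :
    (of cs (w * longest cs)).inv = {t | cs.IsReflection t ∧ t ∉ (of cs w).inv} :=
  Set.ext fun t ↦ isLeftInversion_mul_longest_iff cs w t

/-- Multiplication by the longest element, as an anti-automorphism of the weak order. -/
noncomputable def mulLongest (cs : CoxeterSystem M W) : WeakOrder cs ≃o (WeakOrder cs)ᵒᵈ where
  toEquiv := (Equiv.mulRight (longest cs)).trans OrderDual.toDual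
  map_rel_iff' := by
    intro (x : W) (y : W)
    change (of cs (y * longest cs)).inv ⊆ (of cs (x * longest cs)).inv ↔
      (of cs x).inv ⊆ (of cs y).inv
    rw [inv_of_mul_longest, inv_of_mul_longest]
    constructor
    · intro h t ht
      by_contra hty
      exact (h ⟨ht.1, hty⟩).2 ht
    · exact fun h t ht ↦ ⟨ht.1, fun hx ↦ ht.2 (h hx)⟩

/-- The anti-automorphism `w ↦ w w₀` maps the generators of the Cambrian congruence of the opposite
orientation to pairs `(x ∨ c, y ∨ c)`, where `(x, y)` is a generator of the Cambrian congruence and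
`c` is the element whose left inversions are the reflections outside of the dihedral parabolic
subgroup. -/
theorem cambrianCongruence_mul_longest {x y : W}
    (h : cambrianCongruence cs G.op (of cs x) (of cs y)) :
    cambrianCongruence cs G (of cs (x * longest cs)) (of cs (y * longest cs)) := by
  refine cambrianCongruence_le ((isLatticeCongruence_cambrianCongruence (G := G)).dual.comap_orderIso
    (mulLongest cs)) (fun s t (hst : G.Arrow t s) ↦ ?_) h
  change cambrianCongruence cs G (of cs (cs.simple t * longest cs))
    (of cs (alternating cs t s (M s t - 1) * longest cs))
  obtain ⟨c, hc⟩ := exists_inv_eq_union {s, t} (of cs 1)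
  rw [inv_of_one, Set.empty_union] at hc
  have hgen := cambrianCongruence_of_arrow (cs := cs) hst
  rw [M.symmetric t s] at hgen
  refine isLatticeCongruence_cambrianCongruence.sup _ _ c c _ _ (Setoid.symm' _ hgen)
    (Setoid.refl' _ c) (isLUB_of_inv_eq ?_) (isLUB_of_inv_eq ?_)
  · have hs := inv_alternating_pred (cs := cs) hst.ne
    rw [M.symmetric t s] at hs
    rw [inv_of_mul_longest, hc, hs, inv_of_simple, Set.pair_comm t s]
    ext r
    have ht : cs.simple t ∈ parabolic cs {s, t} := (simple_mem_parabolic_iff cs).2 (by simp)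
    by_cases hr : r = cs.simple t
    · subst hr
      simp [reflections, ht]
    · by_cases hrI : r ∈ parabolic cs {s, t} <;> simp [reflections, hr, hrI]
  · rw [inv_of_mul_longest, hc, inv_alternating_pred hst.ne.symm, inv_of_simple]
    ext r
    have hs : cs.simple s ∈ parabolic cs {s, t} := (simple_mem_parabolic_iff cs).2 (by simp)
    by_cases hr : r = cs.simple s
    · subst hr
      simp [hs, cs.isReflection_simple]
    · by_cases hrI : r ∈ parabolic cs {s, t} <;> simp [reflections, hr, hrI]

/-- Multiplication by the longest element is an anti-isomorphism between the Cambrian lattices of an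
orientation and of its opposite. -/
theorem exists_orderIso_op (cs : CoxeterSystem M W) (G : DirectedDiagram M) :
    ∃ F : CambrianLattice cs G.op ≃o (CambrianLattice cs G)ᵒᵈ,
      ∀ w : W, F (CambrianLattice.mk cs G.op w) =
        OrderDual.toDual (CambrianLattice.mk cs G (w * longest cs)) := by
  refine ⟨CambrianLattice.dualCongr (mulLongest cs)
    fun (x : W) (y : W) ↦ ⟨cambrianCongruence_mul_longest, fun h ↦ ?_⟩, fun w ↦ rfl⟩
  have := cambrianCongruence_mul_longest (G := G.op) (x := x * longest cs)
    (y := y * longest cs) h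
  have hx : ∀ z : W, z * longest cs * longest cs = z := fun z ↦ by
    rw [mul_assoc, longest_mul_longest, mul_one]
  change cambrianCongruence cs G.op (of cs (x * longest cs * longest cs))
    (of cs (y * longest cs * longest cs)) at this
  rwa [hx, hx] at this

end Opposite

end Transport

end Cambrian

open Cambrian in
/-- For finite Coxeter systems and orientations `G`, `G'` of their diagrams:
an isomorphism `φ` of directed diagrams extends to a group isomorphism `f`, and `[w] ↦ [f w]` is an
isomorphism of Cambrian lattices; an anti-isomorphism `φ` of directed diagrams extends to a group
isomorphism `f`, and `[w] ↦ [f w * w₀']` is an anti-isomorphism of Cambrian lattices; an isomorphism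
of Cambrian lattices maps the atoms `[s]` to the atoms `[φ s]` for a unique bijection `φ`, an
isomorphism of directed diagrams; an anti-isomorphism of Cambrian lattices maps the atoms `[s]` to
the coatoms `[φ s * w₀']` for a unique bijection `φ`, an anti-isomorphism of directed diagrams. -/
theorem theorem3p3 {B B' W W' : Type*} [Group W] [Group W'] [Finite W] [Finite W']
    {M : CoxeterMatrix B} {M' : CoxeterMatrix B'}
    (cs : CoxeterSystem M W) (cs' : CoxeterSystem M' W')
    (G : DirectedDiagram M) (G' : DirectedDiagram M') :
    (∀ φ : B ≃ B', G.IsIso G' φ →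
      ∃ f : W ≃* W', (∀ s, f (cs.simple s) = cs'.simple (φ s)) ∧
        ∃ F : CambrianLattice cs G ≃o CambrianLattice cs' G',
          ∀ w : W, F (CambrianLattice.mk cs G w) = CambrianLattice.mk cs' G' (f w)) ∧
    (∀ φ : B ≃ B', G.IsAntiIso G' φ →
      ∃ f : W ≃* W', (∀ s, f (cs.simple s) = cs'.simple (φ s)) ∧
        ∃ F : CambrianLattice cs G ≃o (CambrianLattice cs' G')ᵒᵈ,
          ∀ w : W, F (CambrianLattice.mk cs G w) =
            OrderDual.toDual (CambrianLattice.mk cs' G' (f w * longest cs'))) ∧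
    (∀ F : CambrianLattice cs G ≃o CambrianLattice cs' G',
      ∃! φ : B ≃ B', G.IsIso G' φ ∧
        ∀ s, F (CambrianLattice.mk cs G (cs.simple s)) =
          CambrianLattice.mk cs' G' (cs'.simple (φ s))) ∧
    (∀ F : CambrianLattice cs G ≃o (CambrianLattice cs' G')ᵒᵈ,
      ∃! φ : B ≃ B', G.IsAntiIso G' φ ∧
        ∀ s, F (CambrianLattice.mk cs G (cs.simple s)) =
          OrderDual.toDual
            (CambrianLattice.mk cs' G' (cs'.simple (φ s) * longest cs'))) := by
  -- An anti-isomorphism `G → G'` is by definition the same as an isomorphism `G → G'.op`.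
  obtain ⟨D, hD⟩ := exists_orderIso_op cs' G'
  refine ⟨fun φ hφ ↦ exists_orderIso_of_isIso cs cs' hφ, fun φ hφ ↦ ?_,
    CambrianLattice.existsUnique_isIso, fun F ↦ ?_⟩
  · obtain ⟨f, hf, F, hF⟩ := exists_orderIso_of_isIso (G' := G'.op) cs cs' hφ
    exact ⟨f, hf, F.trans D, fun w ↦ by rw [OrderIso.trans_apply, hF, hD]⟩
  · have h := CambrianLattice.existsUnique_isIso (F.trans D.symm)
    simp only [OrderIso.trans_apply, OrderIso.symm_apply_eq, hD] at h
    exact h
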